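/- Let $m\ge n\ge 0$ be integers, $k\in\mathbb C$, $\alpha_1=k+n$, $\alpha_2=k+m$. For $1\le i\le m+n$ put $\mathrm{col}(i)=1$, $\mathrm{row}(i)=i$ if $i\le m$, and $\mathrm{col}(i)=2$, $\mathrm{row}(i)=i-n$ if $i>m$. Let $\hat i$ (resp. $\tilde i$) be the index in the same row as $i$ and in column $\mathrm{col}(i)+1$ (resp. $\mathrm{col}(i)-1$), if it exists; terms containing a non-existent index are $0$. Let $\mathfrak b\subset\mathfrak{gl}(m+n)$ be the span of the matrix units $e_{i,j}$ with $\mathrm{col}(i)\ge\mathrm{col}(j)$, with the invariant form $\kappa(e_{i,j},e_{p,q})=\alpha_c\delta_{i,q}\delta_{p,j}+\delta_{i,j}\delta_{p,q}$ if $i,j,p,q$ all lie in the same column $c$, and $0$ otherwise. Let $\mathfrak a=\mathfrak b\oplus\bigoplus_{\mathrm{col}(i)>\mathrm{col}(j)}\mathbb C\psi_{i,j}$ be the Lie superalgebra with $\psi_{i,j}$ odd, $[e_{i,j},\psi_{p,q}]=\delta_{j,p}\psi_{i,q}-\delta_{i,q}\psi_{p,j}$, $[\psi_{i,j},\psi_{p,q}]=0$,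 and let $\tilde\kappa$ be $\kappa$ extended by $0$ to the odd part. Let $V^\kappa(\mathfrak b)\subset V^{\tilde\kappa}(\mathfrak a)$ be the universal affine vertex (super)algebras, and write $x[-s]=xt^{-s}|0\rangle$. Let $d_0:V^\kappa(\mathfrak b)\to V^{\tilde\kappa}(\mathfrak a)$ be the odd derivation of all $s$-th products that kills $|0\rangle$, commutes with $\partial$, and satisfies $$d_0(e_{i,j}[-1])=\sum_{\mathrm{col}(i)>\mathrm{col}(r)\ge\mathrm{col}(j)}e_{r,j}[-1]\psi_{i,r}[-1]-\sum_{\mathrm{col}(j)<\mathrm{col}(r)\le\mathrm{col}(i)}\psi_{r,j}[-1]e_{i,r}[-1]+\delta(\mathrm{col}(i)>\mathrm{col}(j))\,\alpha_2\psi_{i,j}[-2]+\psi_{\hat i,j}[-1]-\psi_{i,\tilde j}[-1],$$ where products are $(-1)$-st products and $\delta(P)$ is $1$ if $P$ holds and $0$ otherwise. The $W$-algebra of $\mathfrak{gl}(m+n)$ at level $k$ and the nilpotent $f=\sum_{j=m+1}^{m+n}e_{j,j-n}$ (Jordan type $(2^n,1^{m-n})$) is the vertex algebra $\mathcal W=\{y\in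 V^\kappa(\mathfrak b)\mid d_0y=0\}$, graded by conformal weight, where $e_{i,j}[-1]$ has weight $1+\mathrm{col}(i)-\mathrm{col}(j)$. For $1\le i\le m-n,\ 1\le j\le m$, and for $m-n<i,j\le m$, set $$W^{(1)}_{i,j}=\sum_{\substack{\mathrm{row}(h)=i,\ \mathrm{row}(l)=j\\ \mathrm{col}(h)=\mathrm{col}(l)}}e_{h,l}[-1]\in\mathcal W .$$ Let $\mathcal U(\mathcal W)$ be the universal enveloping algebra of the vertex algebra $\mathcal W$: with $L(\mathcal W)=\mathcal W\otimes\mathbb C[t^{\pm1}]/\mathrm{Im}(\partial\otimes\mathrm{id}+\mathrm{id}\otimes\frac{d}{dt})$ the Lie algebra with bracket $[ut^a,vt^b]=\sum_{r\ge0}\binom ar(u_{(r)}v)t^{a+b-r}$, graded by $\deg(ut^a)=a-\mathrm{wt}(u)+1$, it is the quotient of the degreewise completion $\bigoplus_d\varprojlim_N U(L(\mathcal W))_d/\sum_{r>N}U(L(\mathcal W))_{d-r}U(L(\mathcal W))_r$ by the degreewise closure of the two-sided ideal generated by $|0\rangle t^{-1}-1$ and all $(u_{(a)}v)t^b-\sum_{i\ge0}\binom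 ai(-1)^i\bigl(ut^{a-i}vt^{b+i}-(-1)^avt^{a+b-i}ut^i\bigr)$. **Theorem.** (1) For all index pairs $(p,q)$, $(i,j)$ for which $W^{(1)}_{p,q}$ and $W^{(1)}_{i,j}$ are defined, $$(W^{(1)}_{p,q})_{(0)}W^{(1)}_{i,j}=\delta_{q,i}W^{(1)}_{p,j}-\delta_{p,j}W^{(1)}_{i,q},$$ $$(W^{(1)}_{p,q})_{(1)}W^{(1)}_{i,j}=\delta_{q,i}\delta_{p,j}\bigl(\alpha_1+\delta(p,i>m-n)\alpha_2\bigr)|0\rangle+\delta_{p,q}\delta_{i,j}\bigl(1+\delta(p,i>m-n)\bigr)|0\rangle,$$ $$(W^{(1)}_{p,q})_{(s)}W^{(1)}_{i,j}=0\quad\text{for all }s>1,$$ where $\delta(p,i>m-n)$ is $1$ if both $p>m-n$ and $i>m-n$, and $0$ otherwise. (2) For all $i,j,p,q>m-n$ and all $s,u\in\mathbb Z$, in $\mathcal U(\mathcal W)$, $$[W^{(1)}_{p,q}t^s,W^{(1)}_{i,j}t^u]=\delta_{q,i}W^{(1)}_{p,j}t^{s+u}-\delta_{p,j}W^{(1)}_{i,q}t^{s+u}+\delta_{s+u,0}\delta_{q,i}\delta_{p,j}\,s(\alpha_1+\alpha_2)+2\,\delta_{s+u,0}\delta_{p,q}\delta_{i,j}\,s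 .$$ -/

import Mathlib

open scoped Topology

/-! ### Fields and their products -/

section Fields

variable {M : Type*} [AddCommGroup M] [Module ℂ M]

/-- A family of endomorphisms `f n`, `n ∈ ℤ`, such that for every `v` one has `f n v = 0` for
`n ≫ 0`, packaged as the field `∑ n, f n z ^ (-n - 1)`. -/
noncomputable def mkField (f : ℤ → Module.End ℂ M)
    (hf : ∀ v, ∃ N : ℤ, ∀ n, N ≤ n → f n v = 0) : VertexOperator ℂ M :=
  VertexOperator.of_coeff (fun k => f (-k - 1)) (by
    intro v
    obtain ⟨N, hN⟩ := hf v
    refine ⟨-N, ?_⟩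
    intro k hk
    by_contra hlt
    exact hk (hN _ (by omega)))

open VertexOperator in
@[simp]
theorem mkField_ncoeff (f : ℤ → Module.End ℂ M)
    (hf : ∀ v, ∃ N : ℤ, ∀ n, N ≤ n → f n v = 0) (n : ℤ) : ncoeff (mkField f hf) n = f n := by
  unfold mkField
  rw [VertexOperator.ncoeff_of_coeff]
  congr 1
  omega

theorem field_ext {A B : VertexOperator ℂ M}
    (h : ∀ n v, VertexOperator.ncoeff A n v = VertexOperator.ncoeff B n v) : A = B := by
  apply HVertexOperator.coeff_inj
  funext n
  ext v
  rw [VertexOperator.coeff_eq_ncoeff, VertexOperator.coeff_eq_ncoeff, h]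

theorem field_trunc (A : VertexOperator ℂ M) (v : M) :
    ∃ N : ℤ, ∀ n, N ≤ n → VertexOperator.ncoeff A n v = 0 := by
  refine ⟨-(HahnSeries.order ((HahnModule.of ℂ).symm (A v))), fun n hn => ?_⟩
  apply VertexOperator.ncoeff_eq_zero_of_lt_order
  omega

/-- The identity field, i.e. the field of the vacuum vector. -/
noncomputable def idField (M : Type*) [AddCommGroup M] [Module ℂ M] : VertexOperator ℂ M :=
  mkField (fun n => if n = -1 then 1 else 0)
    (fun _ => ⟨0, fun n hn => by rw [if_neg (by omega)]; rfl⟩)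

/-- The derivative `∂A(z) = d/dz A(z)`, that is, `(∂A)_(n) = -n A_(n-1)`. -/
noncomputable def derivField (A : VertexOperator ℂ M) : VertexOperator ℂ M :=
  mkField (fun n => (-(n : ℂ)) • VertexOperator.ncoeff A (n - 1)) (by
    intro v
    obtain ⟨N, hN⟩ := field_trunc A v
    exact ⟨N + 1, fun n hn => by simp [hN (n - 1) (by omega)]⟩)

/-- The `i`-th summand of `(A_(n) B)_(m) v`. -/
noncomputable def nProdTerm (n : ℤ) (A B : VertexOperator ℂ M) (m : ℤ) (v : M) (i : ℕ) : M :=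
  ((-1 : ℂ) ^ i * (Ring.choose n i : ℤ)) •
    (VertexOperator.ncoeff A (n - i) (VertexOperator.ncoeff B (m + i) v)
      - ((-1 : ℂ) ^ n) • VertexOperator.ncoeff B (n + m - i) (VertexOperator.ncoeff A i v))

theorem nProdTerm_finite (n : ℤ) (A B : VertexOperator ℂ M) (m : ℤ) (v : M) :
    (Function.support (nProdTerm n A B m v)).Finite := by
  obtain ⟨a, ha⟩ := field_trunc A v
  obtain ⟨b, hb⟩ := field_trunc B v
  refine (Set.finite_lt_nat (a.toNat + (b - m).toNat)).subset ?_
  intro i hi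
  by_contra hlt
  simp only [Set.mem_ofPred_eq, not_lt] at hlt
  apply hi
  simp [nProdTerm, ha i (by omega), hb (m + i) (by omega)]

/-- The `n`-th product of two fields, at least one of which is even (so that no sign occurs when
they are exchanged):
`(A_(n) B)_(m) = ∑_{i ≥ 0} (-1)^i C(n,i) (A_(n-i) B_(m+i) - (-1)^n B_(n+m-i) A_(i))`. -/
noncomputable def nProd (n : ℤ) (A B : VertexOperator ℂ M) : VertexOperator ℂ M :=
  mkField
    (fun m =>
      { toFun := fun v => ∑ᶠ i : ℕ, nProdTerm n A B m v i
        map_add' := by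
          intro v w
          rw [← finsum_add_distrib (nProdTerm_finite n A B m v) (nProdTerm_finite n A B m w)]
          refine finsum_congr fun i => ?_
          simp only [nProdTerm, map_add, smul_add, smul_sub]
          abel
        map_smul' := by
          intro c v
          rw [RingHom.id_apply, smul_finsum' c (nProdTerm_finite n A B m v)]
          refine finsum_congr fun i => ?_
          simp only [nProdTerm, map_smul, smul_sub, smul_smul]
          ring_nf })
    (by
      intro v
      obtain ⟨a, ha⟩ := field_trunc A v
      obtain ⟨b, hb⟩ := field_trunc B v
      choose c hc using fun i : ℕ => field_trunc B (VertexOperator.ncoeff A (i : ℤ) v)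
      obtain ⟨C, hC⟩ : ∃ C : ℤ, ∀ i < a.toNat, c i + i - n ≤ C := by
        induction a.toNat with
        | zero => exact ⟨0, by simp⟩
        | succ K ih =>
          obtain ⟨C, hC⟩ := ih
          refine ⟨max C (c K + K - n), fun i hi => ?_⟩
          rcases Nat.lt_succ_iff_lt_or_eq.mp hi with h | h
          · exact (hC i h).trans (le_max_left _ _)
          · subst h; exact le_max_right _ _
      refine ⟨max b C, fun m hm => ?_⟩
      have hm1 : b ≤ m := (le_max_left _ _).trans hm
      have hm2 : C ≤ m := (le_max_right _ _).trans hm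
      change ∑ᶠ i : ℕ, nProdTerm n A B m v i = 0
      apply finsum_eq_zero_of_forall_eq_zero
      intro i
      by_cases hi : i < a.toNat
      · have h2 := hC i hi
        simp [nProdTerm, hb (m + i) (by omega), hc i (n + m - i) (by omega)]
      · simp [nProdTerm, hb (m + i) (by omega), ha i (by omega)])

theorem nProd_ncoeff (n : ℤ) (A B : VertexOperator ℂ M) (m : ℤ) (v : M) :
    VertexOperator.ncoeff (nProd n A B) m v = ∑ᶠ i : ℕ, nProdTerm n A B m v i := by
  simp [nProd]

theorem zero_nProd (n : ℤ) (B : VertexOperator ℂ M) : nProd n 0 B = 0 := by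
  apply field_ext
  intro m v
  rw [nProd_ncoeff]
  simp [nProdTerm]

theorem nProd_zero (n : ℤ) (A : VertexOperator ℂ M) : nProd n A 0 = 0 := by
  apply field_ext
  intro m v
  rw [nProd_ncoeff]
  simp [nProdTerm]

theorem derivField_zero : derivField (0 : VertexOperator ℂ M) = 0 := by
  apply field_ext
  intro m v
  simp [derivField]

end Fields

/-! ### Universal affine vertex (super)algebras

The Lie superalgebra here is `𝔤 ⊕ N` with even part a Lie algebra `𝔤`, odd part a `𝔤`-module `N`
and vanishing bracket of two odd elements; the form is `κ` on `𝔤` and zero if one argument is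
odd. -/

section Affine

variable (𝔤 N : Type) [LieRing 𝔤] [LieAlgebra ℂ 𝔤] [AddCommGroup N] [Module ℂ N]
  [LieRingModule 𝔤 N] (κ : LinearMap.BilinForm ℂ 𝔤)

/-- The symbols `u t^a` with `u` even or odd. -/
abbrev ModeSymbol := (𝔤 ⊕ N) × ℤ

variable {𝔤 N} in
/-- The symbol `x t^a` for even `x`. -/
def symE (x : 𝔤) (a : ℤ) : FreeAlgebra ℂ (ModeSymbol 𝔤 N) := FreeAlgebra.ι ℂ (Sum.inl x, a)

variable {𝔤 N} in
/-- The symbol `ψ t^a` for odd `ψ`. -/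
def symO (y : N) (a : ℤ) : FreeAlgebra ℂ (ModeSymbol 𝔤 N) := FreeAlgebra.ι ℂ (Sum.inr y, a)

/-- The defining relations of the universal enveloping algebra of the affinization
`(𝔤 ⊕ N)[t, t⁻¹] ⊕ ℂ K` with `K = 1`. -/
inductive ModeRel : FreeAlgebra ℂ (ModeSymbol 𝔤 N) → FreeAlgebra ℂ (ModeSymbol 𝔤 N) → Prop
  | addE (x y : 𝔤) (a : ℤ) : ModeRel (symE (x + y) a) (symE x a + symE y a)
  | smulE (c : ℂ) (x : 𝔤) (a : ℤ) : ModeRel (symE (c • x) a) (c • symE x a)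
  | addO (x y : N) (a : ℤ) : ModeRel (symO (x + y) a) (symO x a + symO y a)
  | smulO (c : ℂ) (x : N) (a : ℤ) : ModeRel (symO (c • x) a) (c • symO x a)
  | commEE (x y : 𝔤) (a b : ℤ) :
      ModeRel (symE x a * symE y b - symE y b * symE x a)
        (symE ⁅x, y⁆ (a + b)
          + algebraMap ℂ _ (if a + b = 0 then (a : ℂ) * κ x y else 0))
  | commEO (x : 𝔤) (y : N) (a b : ℤ) :
      ModeRel (symE x a * symO y b - symO y b * symE x a) (symO ⁅x, y⁆ (a + b))
  | commOO (x y : N) (a b : ℤ) :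
      ModeRel (symO x a * symO y b + symO y b * symO x a) 0

/-- The universal enveloping algebra of the affinization at `K = 1`. -/
abbrev ModeAlg := RingQuot (ModeRel 𝔤 N κ)

/-- The element `x t^a`, `x` even. -/
noncomputable def modeE (x : 𝔤) (a : ℤ) : ModeAlg 𝔤 N κ :=
  RingQuot.mkAlgHom ℂ (ModeRel 𝔤 N κ) (symE x a)

/-- The element `ψ t^a`, `ψ` odd. -/
noncomputable def modeO (y : N) (a : ℤ) : ModeAlg 𝔤 N κ :=
  RingQuot.mkAlgHom ℂ (ModeRel 𝔤 N κ) (symO y a)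

/-- The left ideal generated by all `u t^a` with `a ≥ 0`. -/
def vacuumIdeal : Ideal (ModeAlg 𝔤 N κ) :=
  Ideal.span ({X | ∃ x a, 0 ≤ a ∧ X = modeE 𝔤 N κ x a} ∪ {X | ∃ y a, 0 ≤ a ∧ X = modeO 𝔤 N κ y a})

/-- The vacuum module, the space of states of the universal affine vertex superalgebra. -/
def VacuumModule := ModeAlg 𝔤 N κ ⧸ vacuumIdeal 𝔤 N κ

noncomputable instance : AddCommGroup (VacuumModule 𝔤 N κ) :=
  inferInstanceAs (AddCommGroup (ModeAlg 𝔤 N κ ⧸ vacuumIdeal 𝔤 N κ))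

noncomputable instance : Module (ModeAlg 𝔤 N κ) (VacuumModule 𝔤 N κ) :=
  inferInstanceAs (Module (ModeAlg 𝔤 N κ) (ModeAlg 𝔤 N κ ⧸ vacuumIdeal 𝔤 N κ))

noncomputable instance : Module ℂ (VacuumModule 𝔤 N κ) :=
  inferInstanceAs (Module ℂ (ModeAlg 𝔤 N κ ⧸ vacuumIdeal 𝔤 N κ))

instance : IsScalarTower ℂ (ModeAlg 𝔤 N κ) (VacuumModule 𝔤 N κ) :=
  inferInstanceAs (IsScalarTower ℂ (ModeAlg 𝔤 N κ) (ModeAlg 𝔤 N κ ⧸ vacuumIdeal 𝔤 N κ))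

/-- The class of an element of the mode algebra, i.e. the result of applying it to the vacuum. -/
def VacuumModule.mk : ModeAlg 𝔤 N κ →ₗ[ModeAlg 𝔤 N κ] VacuumModule 𝔤 N κ :=
  Submodule.mkQ (vacuumIdeal 𝔤 N κ)

variable {𝔤 N}

theorem modeE_comm_E (x y : 𝔤) (a b : ℤ) :
    modeE 𝔤 N κ x a * modeE 𝔤 N κ y b = modeE 𝔤 N κ y b * modeE 𝔤 N κ x a
      + (modeE 𝔤 N κ ⁅x, y⁆ (a + b)
        + algebraMap ℂ _ (if a + b = 0 then (a : ℂ) * κ x y else 0)) := by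
  have h := RingQuot.mkAlgHom_rel ℂ (ModeRel.commEE (N := N) (κ := κ) x y a b)
  simp only [map_sub, map_mul, map_add, AlgHom.commutes] at h
  exact (sub_eq_iff_eq_add'.mp h)

theorem modeE_comm_O (x : 𝔤) (y : N) (a b : ℤ) :
    modeE 𝔤 N κ x a * modeO 𝔤 N κ y b = modeO 𝔤 N κ y b * modeE 𝔤 N κ x a
      + modeO 𝔤 N κ ⁅x, y⁆ (a + b) := by
  have h := RingQuot.mkAlgHom_rel ℂ (ModeRel.commEO (N := N) (κ := κ) x y a b)
  simp only [map_sub, map_mul] at h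
  exact (sub_eq_iff_eq_add'.mp h)

theorem modeO_comm_O (x y : N) (a b : ℤ) :
    modeO 𝔤 N κ x a * modeO 𝔤 N κ y b = -(modeO 𝔤 N κ y b * modeO 𝔤 N κ x a) := by
  have h := RingQuot.mkAlgHom_rel ℂ (ModeRel.commOO (𝔤 := 𝔤) (N := N) (κ := κ) x y a b)
  simp only [map_add, map_mul, map_zero] at h
  exact eq_neg_of_add_eq_zero_left h

/-- Every vector of the vacuum module is annihilated by `u t^n` for `n ≫ 0`. -/
theorem vacuum_trunc (v : VacuumModule 𝔤 N κ) :
    (∀ x, ∃ K : ℤ, ∀ n, K ≤ n → modeE 𝔤 N κ x n • v = 0) ∧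
    (∀ y, ∃ K : ℤ, ∀ n, K ≤ n → modeO 𝔤 N κ y n • v = 0) := by
  let P : VacuumModule 𝔤 N κ → Prop := fun v =>
    (∀ x, ∃ K : ℤ, ∀ n, K ≤ n → modeE 𝔤 N κ x n • v = 0) ∧
    (∀ y, ∃ K : ℤ, ∀ n, K ≤ n → modeO 𝔤 N κ y n • v = 0)
  have hadd : ∀ v w, P v → P w → P (v + w) := by
    rintro v w ⟨h1, h2⟩ ⟨h3, h4⟩
    constructor
    · intro x
      obtain ⟨K, hK⟩ := h1 x
      obtain ⟨L, hL⟩ := h3 x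
      exact ⟨max K L, fun n hn => by
        rw [smul_add, hK n (by omega), hL n (by omega), add_zero]⟩
    · intro x
      obtain ⟨K, hK⟩ := h2 x
      obtain ⟨L, hL⟩ := h4 x
      exact ⟨max K L, fun n hn => by
        rw [smul_add, hK n (by omega), hL n (by omega), add_zero]⟩
  have hE : ∀ z b v, P v → P (modeE 𝔤 N κ z b • v) := by
    rintro z b v ⟨h1, h2⟩
    constructor
    · intro x
      obtain ⟨K, hK⟩ := h1 x
      obtain ⟨L, hL⟩ := h1 ⁅x, z⁆
      refine ⟨max (max K (L - b)) (1 - b), fun n hn => ?_⟩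
      rw [smul_smul, modeE_comm_E, add_smul, add_smul, mul_smul, hK n (by omega),
        hL (n + b) (by omega), if_neg (by omega)]
      simp
    · intro y
      obtain ⟨K, hK⟩ := h2 y
      obtain ⟨L, hL⟩ := h2 ⁅z, y⁆
      refine ⟨max K (L - b), fun n hn => ?_⟩
      have h := modeE_comm_O κ z y b n
      rw [smul_smul, ← sub_eq_iff_eq_add.mpr h, sub_smul, mul_smul, hK n (by omega),
        hL (b + n) (by omega)]
      simp
  have hO : ∀ z b v, P v → P (modeO 𝔤 N κ z b • v) := by
    rintro z b v ⟨h1, h2⟩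
    constructor
    · intro x
      obtain ⟨K, hK⟩ := h1 x
      obtain ⟨L, hL⟩ := h2 ⁅x, z⁆
      refine ⟨max K (L - b), fun n hn => ?_⟩
      rw [smul_smul, modeE_comm_O, add_smul, mul_smul, hK n (by omega), hL (n + b) (by omega)]
      simp
    · intro y
      obtain ⟨K, hK⟩ := h2 y
      refine ⟨K, fun n hn => ?_⟩
      rw [smul_smul, modeO_comm_O, neg_smul, mul_smul, hK n hn]
      simp
  have hc : ∀ (c : ℂ) v, P v → P (c • v) := by
    rintro c v ⟨h1, h2⟩
    constructor
    · intro x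
      obtain ⟨K, hK⟩ := h1 x
      exact ⟨K, fun n hn => by rw [smul_comm, hK n hn]; exact smul_zero (A := VacuumModule 𝔤 N κ) c⟩
    · intro x
      obtain ⟨K, hK⟩ := h2 x
      exact ⟨K, fun n hn => by rw [smul_comm, hK n hn]; exact smul_zero (A := VacuumModule 𝔤 N κ) c⟩
  have hact : ∀ (X : FreeAlgebra ℂ (ModeSymbol 𝔤 N)) v, P v →
      P (RingQuot.mkAlgHom ℂ (ModeRel 𝔤 N κ) X • v) := by
    intro X
    induction X using FreeAlgebra.induction with
    | grade0 r =>
      intro v hv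
      rw [AlgHom.commutes, algebraMap_smul]
      exact hc r v hv
    | grade1 s =>
      intro v hv
      obtain ⟨s | s, b⟩ := s
      · exact hE s b v hv
      · exact hO s b v hv
    | mul a b ha hb =>
      intro v hv
      rw [map_mul, mul_smul]
      exact ha _ (hb _ hv)
    | add a b ha hb =>
      intro v hv
      rw [map_add, add_smul]
      exact hadd _ _ (ha _ hv) (hb _ hv)
  have hvac : P (VacuumModule.mk 𝔤 N κ 1) := by
    constructor
    · intro x
      refine ⟨0, fun n hn => ?_⟩
      rw [← map_smul, smul_eq_mul, mul_one]
      refine (Submodule.Quotient.mk_eq_zero _).mpr ?_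
      exact Ideal.subset_span (Or.inl ⟨x, n, hn, rfl⟩)
    · intro x
      refine ⟨0, fun n hn => ?_⟩
      rw [← map_smul, smul_eq_mul, mul_one]
      refine (Submodule.Quotient.mk_eq_zero _).mpr ?_
      exact Ideal.subset_span (Or.inr ⟨x, n, hn, rfl⟩)
  obtain ⟨X, rfl⟩ := Submodule.Quotient.mk_surjective _ v
  obtain ⟨F, rfl⟩ := RingQuot.mkAlgHom_surjective ℂ (ModeRel 𝔤 N κ) X
  have := hact F _ hvac
  rwa [← map_smul, smul_eq_mul, mul_one] at this

variable (N) in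
/-- The even current `x(z) = ∑ n, (x t^n) z^(-n-1)`. -/
noncomputable def currentE (x : 𝔤) : VertexOperator ℂ (VacuumModule 𝔤 N κ) :=
  mkField (fun n => Algebra.lsmul ℂ ℂ _ (modeE 𝔤 N κ x n))
    (fun v => by simpa using (vacuum_trunc κ v).1 x)

/-- The odd current `ψ(z) = ∑ n, (ψ t^n) z^(-n-1)`. -/
noncomputable def currentO (y : N) : VertexOperator ℂ (VacuumModule 𝔤 N κ) :=
  mkField (fun n => Algebra.lsmul ℂ ℂ _ (modeO 𝔤 N κ y n))
    (fun v => by simpa using (vacuum_trunc κ v).2 y)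

end Affine

/-! ### The `W`-algebra of `gl(m+n)` and a nilpotent element of Jordan type `(2^n, 1^(m-n))`

Indices are counted from `0`: the index `i : Fin (m + n)` stands for `i + 1`. -/

attribute [local instance] LieRing.ofAssociativeRing

section WAlgebra

variable (m n : ℕ)

/-- The column of a box. -/
def col (i : Fin (m + n)) : ℕ := if (i : ℕ) < m then 1 else 2

/-- The row of a box, counted from `0`. -/
def row (i : Fin (m + n)) : ℕ := if (i : ℕ) < m then (i : ℕ) else (i : ℕ) - n

/-- `gl(m+n)`. -/
abbrev glMat := Matrix (Fin (m + n)) (Fin (m + n)) ℂ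

/-- The subalgebra `𝔟` of `gl(m+n)` spanned by the `e_{i,j}` with `col i ≥ col j`. -/
def lieB : LieSubalgebra ℂ (glMat m n) where
  carrier := {x | ∀ i j, col m n i < col m n j → x i j = 0}
  add_mem' := by
    intro x y hx hy i j h
    simp [hx i j h, hy i j h]
  zero_mem' := by
    intro i j _
    rfl
  smul_mem' := by
    intro c x hx i j h
    simp [hx i j h]
  lie_mem' := by
    intro x y hx hy i j h
    have aux : ∀ x y : glMat m n, (∀ i j, col m n i < col m n j → x i j = 0) →
        (∀ i j, col m n i < col m n j → y i j = 0) → (x * y) i j = 0 := by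
      intro x y hx hy
      rw [Matrix.mul_apply]
      refine Finset.sum_eq_zero fun l _ => ?_
      by_cases hl : col m n i < col m n l
      · rw [hx i l hl, zero_mul]
      · rw [hy l j (by omega), mul_zero]
    rw [Ring.lie_def, Matrix.sub_apply, aux x y hx hy, aux y x hy hx, sub_zero]

/-- The `𝔟`-module (under the adjoint action) spanned by the `e_{i,j}` with `col i > col j`; its
parity-changed copy is the span of the odd elements `ψ_{i,j}`. -/
def oddPart : LieSubmodule ℂ (lieB m n) (glMat m n) where
  carrier := {x | ∀ i j, col m n i ≤ col m n j → x i j = 0}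
  add_mem' := by
    intro x y hx hy i j h
    simp [hx i j h, hy i j h]
  zero_mem' := by
    intro i j _
    rfl
  smul_mem' := by
    intro c x hx i j h
    simp [hx i j h]
  lie_mem := by
    intro x y hy i j h
    have hx := x.2
    rw [LieSubalgebra.coe_bracket_of_module, Ring.lie_def, Matrix.sub_apply, Matrix.mul_apply,
      Matrix.mul_apply, Finset.sum_eq_zero, Finset.sum_eq_zero, sub_zero]
    · intro l _
      by_cases hl : col m n i ≤ col m n l
      · rw [hy i l hl, zero_mul]
      · rw [hx l j (by omega), mul_zero]
    · intro l _
      by_cases hl : col m n i < col m n l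
      · rw [hx i l hl, zero_mul]
      · rw [hy l j (by omega), mul_zero]

/-- `∑ x_{i,j} y_{j,i}` over `i, j` in column `c`. -/
def blockPairing (c : ℕ) (x y : glMat m n) : ℂ :=
  ∑ i, ∑ j, if col m n i = c ∧ col m n j = c then x i j * y j i else 0

/-- `∑ x_{i,i}` over `i` in column `c`. -/
def blockTrace (c : ℕ) (x : glMat m n) : ℂ :=
  ∑ i, if col m n i = c then x i i else 0

variable (k : ℂ)

/-- `α₁ = k + n`. -/
def alpha1 (n : ℕ) (k : ℂ) : ℂ := k + n

/-- `α₂ = k + m`. -/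
def alpha2 (m : ℕ) (k : ℂ) : ℂ := k + m

/-- The form `κ` on `𝔟`: it is `α_c δ_{i,q} δ_{p,j} + δ_{i,j} δ_{p,q}` on `(e_{i,j}, e_{p,q})` if
`i, j, p, q` all lie in column `c`, and zero on all other pairs of basis elements. -/
noncomputable def kappa : LinearMap.BilinForm ℂ (lieB m n) :=
  LinearMap.mk₂ ℂ
    (fun x y =>
      (alpha1 n k * blockPairing m n 1 x y + blockTrace m n 1 x * blockTrace m n 1 y)
      + (alpha2 m k * blockPairing m n 2 x y + blockTrace m n 2 x * blockTrace m n 2 y))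
    (by
      intro x x' y
      have h1 : ∀ c, blockPairing m n c (x + x' : lieB m n) y
          = blockPairing m n c x y + blockPairing m n c x' y := by
        intro c
        simp only [blockPairing, ← Finset.sum_add_distrib]
        refine Finset.sum_congr rfl fun i _ => Finset.sum_congr rfl fun j _ => ?_
        split_ifs <;> simp [add_mul]
      have h2 : ∀ c, blockTrace m n c (x + x' : lieB m n)
          = blockTrace m n c x + blockTrace m n c x' := by
        intro c
        simp only [blockTrace, ← Finset.sum_add_distrib]
        refine Finset.sum_congr rfl fun i _ => ?_
        split_ifs <;> simp
      rw [h1, h1, h2, h2]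
      ring)
    (by
      intro a x y
      have h1 : ∀ c, blockPairing m n c (a • x : lieB m n) y = a * blockPairing m n c x y := by
        intro c
        simp only [blockPairing, Finset.mul_sum]
        refine Finset.sum_congr rfl fun i _ => Finset.sum_congr rfl fun j _ => ?_
        split_ifs <;> simp [mul_assoc]
      have h2 : ∀ c, blockTrace m n c (a • x : lieB m n) = a * blockTrace m n c x := by
        intro c
        simp only [blockTrace, Finset.mul_sum]
        refine Finset.sum_congr rfl fun i _ => ?_
        split_ifs <;> simp
      rw [h1, h1, h2, h2, smul_eq_mul]
      ring)
    (by
      intro x y y'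
      have h1 : ∀ c, blockPairing m n c x (y + y' : lieB m n)
          = blockPairing m n c x y + blockPairing m n c x y' := by
        intro c
        simp only [blockPairing, ← Finset.sum_add_distrib]
        refine Finset.sum_congr rfl fun i _ => Finset.sum_congr rfl fun j _ => ?_
        split_ifs <;> simp [mul_add]
      have h2 : ∀ c, blockTrace m n c (y + y' : lieB m n)
          = blockTrace m n c y + blockTrace m n c y' := by
        intro c
        simp only [blockTrace, ← Finset.sum_add_distrib]
        refine Finset.sum_congr rfl fun i _ => ?_
        split_ifs <;> simp
      rw [h1, h1, h2, h2]
      ring)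
    (by
      intro a x y
      have h1 : ∀ c, blockPairing m n c x (a • y : lieB m n) = a * blockPairing m n c x y := by
        intro c
        simp only [blockPairing, Finset.mul_sum]
        refine Finset.sum_congr rfl fun i _ => Finset.sum_congr rfl fun j _ => ?_
        split_ifs <;> simp [mul_left_comm]
      have h2 : ∀ c, blockTrace m n c (a • y : lieB m n) = a * blockTrace m n c y := by
        intro c
        simp only [blockTrace, Finset.mul_sum]
        refine Finset.sum_congr rfl fun i _ => ?_
        split_ifs <;> simp
      rw [h1, h1, h2, h2, smul_eq_mul]
      ring)

/-- The element `e_{i,j}` of `𝔟` (zero if `e_{i,j}` does not belong to `𝔟`). -/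
noncomputable def eElt (i j : Fin (m + n)) : lieB m n :=
  if h : col m n j ≤ col m n i then
    ⟨Matrix.single i j 1, by
      intro p q hpq
      rw [Matrix.single_apply, if_neg]
      rintro ⟨rfl, rfl⟩
      omega⟩
  else 0

/-- The odd element `ψ_{i,j}` (zero if not `col i > col j`). -/
noncomputable def psiElt (i j : Fin (m + n)) : oddPart m n :=
  if h : col m n j < col m n i then
    ⟨Matrix.single i j 1, by
      intro p q hpq
      rw [Matrix.single_apply, if_neg]
      rintro ⟨rfl, rfl⟩
      omega⟩
  else 0

/-- The vacuum module of the affinization of `𝔟`, i.e. the space of states of `V^κ(𝔟)`. -/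
def StatesB : Type :=
  VacuumModule (lieB m n) (⊥ : LieSubmodule ℂ (lieB m n) (glMat m n)) (kappa m n k)

noncomputable instance : AddCommGroup (StatesB m n k) :=
  inferInstanceAs (AddCommGroup (VacuumModule (lieB m n) _ (kappa m n k)))

noncomputable instance : Module ℂ (StatesB m n k) :=
  inferInstanceAs (Module ℂ (VacuumModule (lieB m n) _ (kappa m n k)))

/-- The vacuum module of the affinization of the Lie superalgebra `𝔞`, i.e. the space of states
of `V^κ̃(𝔞)`. -/
def StatesA : Type := VacuumModule (lieB m n) (oddPart m n) (kappa m n k)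

noncomputable instance : AddCommGroup (StatesA m n k) :=
  inferInstanceAs (AddCommGroup (VacuumModule (lieB m n) (oddPart m n) (kappa m n k)))

noncomputable instance : Module ℂ (StatesA m n k) :=
  inferInstanceAs (Module ℂ (VacuumModule (lieB m n) (oddPart m n) (kappa m n k)))

/-- Fields on the vacuum module of the affinization of `𝔟`. -/
abbrev FieldsB := VertexOperator ℂ (StatesB m n k)

/-- Fields on the vacuum module of the affinization of the Lie superalgebra `𝔞`. -/
abbrev FieldsA := VertexOperator ℂ (StatesA m n k)

/-- `e_{i,j}[-1]` in `V^κ(𝔟)`, as a field. -/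
noncomputable def eB (i j : Fin (m + n)) : FieldsB m n k :=
  currentE (⊥ : LieSubmodule ℂ (lieB m n) (glMat m n)) (kappa m n k) (eElt m n i j)

/-- `e_{i,j}[-1]` in `V^κ̃(𝔞)`, as a field. -/
noncomputable def eA (i j : Fin (m + n)) : FieldsA m n k :=
  currentE (oddPart m n) (kappa m n k) (eElt m n i j)

/-- `ψ_{i,j}[-1]` in `V^κ̃(𝔞)`, as a field. -/
noncomputable def psiA (i j : Fin (m + n)) : FieldsA m n k :=
  currentO (kappa m n k) (psiElt m n i j)

/-- The homogeneous elements of `V^κ(𝔟)`, i.e. of the space of fields generated by the currents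
`e_{i,j}(z)`, with their conformal weight: `e_{i,j}[-1]` has weight `1 + col i - col j`. -/
inductive HomogB : ℤ → FieldsB m n k → Prop
  | vac : HomogB 0 (idField _)
  | gen (i j : Fin (m + n)) (h : col m n j ≤ col m n i) :
      HomogB (1 + (col m n i : ℤ) - col m n j) (eB m n k i j)
  | zero (d : ℤ) : HomogB d 0
  | add {d : ℤ} {A B : FieldsB m n k} : HomogB d A → HomogB d B → HomogB d (A + B)
  | smul {d : ℤ} (c : ℂ) {A : FieldsB m n k} : HomogB d A → HomogB d (c • A)
  | deriv {d : ℤ} {A : FieldsB m n k} : HomogB d A → HomogB (d + 1) (derivField A)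
  | nProd {d e : ℤ} (r : ℤ) {A B : FieldsB m n k} :
      HomogB d A → HomogB e B → HomogB (d + e - r - 1) (nProd r A B)

/-- The subspace of `V^κ(𝔟)` of conformal weight `d`. -/
def affineBWeight (d : ℤ) : Submodule ℂ (FieldsB m n k) where
  carrier := {A | HomogB m n k d A}
  add_mem' := HomogB.add
  zero_mem' := HomogB.zero d
  smul_mem' := fun c _ h => HomogB.smul c h

/-- The universal affine vertex algebra `V^κ(𝔟)`, realized (by the state-field correspondence) as
the space of fields on the vacuum module generated by the currents. -/
noncomputable def affineB : Submodule ℂ (FieldsB m n k) := ⨆ d, affineBWeight m n k d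

/-- The value of `d₀` on `e_{i,j}[-1]`; `ψ_{î,j}` and `ψ_{i,j̃}` are written as sums over the at
most one index `î` with `col î = col i + 1`, `row î = row i`, and the at most one index `j̃` with
`col j̃ = col j - 1`, `row j̃ = row j`. -/
noncomputable def d0Gen (i j : Fin (m + n)) : FieldsA m n k :=
  (∑ r, if col m n r < col m n i ∧ col m n j ≤ col m n r then
      nProd (-1) (eA m n k r j) (psiA m n k i r) else 0)
  - (∑ r, if col m n j < col m n r ∧ col m n r ≤ col m n i then
      nProd (-1) (psiA m n k r j) (eA m n k i r) else 0)
  + (if col m n j < col m n i then alpha2 m k • derivField (psiA m n k i j) else 0)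
  + (∑ h, if col m n h = col m n i + 1 ∧ row m n h = row m n i then psiA m n k h j else 0)
  - (∑ l, if col m n l + 1 = col m n j ∧ row m n l = row m n j then psiA m n k i l else 0)

/-- The graph of `d₀ : V^κ(𝔟) → V^κ̃(𝔞)` together with the embedding `V^κ(𝔟) ⊆ V^κ̃(𝔞)`:
`GraphD0 y y' z` says that the element `y` of `V^κ(𝔟)` is `y'` in `V^κ̃(𝔞)`, and `d₀ y = z`.
The map `d₀` kills the vacuum, commutes with `∂`, is a derivation of all products (all elements
of `V^κ(𝔟)` are even, so there are no signs), and is given by `d0Gen` on the generators. -/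
inductive GraphD0 : FieldsB m n k → FieldsA m n k → FieldsA m n k → Prop
  | vac : GraphD0 (idField _) (idField _) 0
  | gen (i j : Fin (m + n)) (h : col m n j ≤ col m n i) :
      GraphD0 (eB m n k i j) (eA m n k i j) (d0Gen m n k i j)
  | add {y₁ y₂ : FieldsB m n k} {y₁' y₂' z₁ z₂ : FieldsA m n k} :
      GraphD0 y₁ y₁' z₁ → GraphD0 y₂ y₂' z₂ → GraphD0 (y₁ + y₂) (y₁' + y₂') (z₁ + z₂)
  | smul (c : ℂ) {y : FieldsB m n k} {y' z : FieldsA m n k} :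
      GraphD0 y y' z → GraphD0 (c • y) (c • y') (c • z)
  | deriv {y : FieldsB m n k} {y' z : FieldsA m n k} :
      GraphD0 y y' z → GraphD0 (derivField y) (derivField y') (derivField z)
  | nProd (r : ℤ) {y₁ y₂ : FieldsB m n k} {y₁' y₂' z₁ z₂ : FieldsA m n k} :
      GraphD0 y₁ y₁' z₁ → GraphD0 y₂ y₂' z₂ →
      GraphD0 (nProd r y₁ y₂) (nProd r y₁' y₂') (nProd r z₁ y₂' + nProd r y₁' z₂)

/-- The kernel of `d₀`. -/
def kerD0 : Submodule ℂ (FieldsB m n k) where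
  carrier := {y | ∃ y', GraphD0 m n k y y' 0}
  add_mem' := by
    rintro a b ⟨a', ha⟩ ⟨b', hb⟩
    exact ⟨a' + b', by simpa using ha.add hb⟩
  zero_mem' := ⟨0, by simpa using (GraphD0.vac (m := m) (n := n) (k := k)).smul 0⟩
  smul_mem' := by
    rintro c a ⟨a', ha⟩
    exact ⟨c • a', by simpa using ha.smul c⟩

/-- The `W`-algebra `W^k(gl(m+n), f) = {y ∈ V^κ(𝔟) | d₀ y = 0}`. -/
noncomputable def wAlgebra : Submodule ℂ (FieldsB m n k) := affineB m n k ⊓ kerD0 m n k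

/-- The subspace of the `W`-algebra of conformal weight `d`. -/
noncomputable def wWeight (d : ℤ) : Submodule ℂ (FieldsB m n k) := affineBWeight m n k d ⊓ kerD0 m n k

theorem wWeight_le (d : ℤ) : wWeight m n k d ≤ wAlgebra m n k :=
  inf_le_inf_right _ (le_iSup (affineBWeight m n k) d)

/-- The index pairs of the `W^{(1)}_{i,j}`: either `i ≤ m - n` and `j ≤ m`, or `i, j > m - n`
(in the numbering from `1`). -/
def validW1 (i j : Fin m) : Prop :=
  (i : ℕ) < m - n ∨ (m - n ≤ (i : ℕ) ∧ m - n ≤ (j : ℕ))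

instance (i j : Fin m) : Decidable (validW1 m n i j) := by unfold validW1; infer_instance

/-- The sum of all `e_{h,l}[-1]` with `row h = i`, `row l = j`, `col h = col l`. -/
noncomputable def w1Sum (i j : Fin m) : FieldsB m n k :=
  ∑ h, ∑ l, if row m n h = i ∧ row m n l = j ∧ col m n h = col m n l then eB m n k h l else 0

theorem w1Sum_homog (i j : Fin m) : w1Sum m n k i j ∈ affineBWeight m n k 1 := by
  unfold w1Sum
  refine Submodule.sum_mem _ fun h _ => Submodule.sum_mem _ fun l _ => ?_
  split_ifs with H
  · have := HomogB.gen (m := m) (n := n) (k := k) h l H.2.2.ge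
    rw [H.2.2] at this
    have h2 : (1 + (col m n l : ℤ) - col m n l) = 1 := by omega
    rwa [h2] at this
  · exact Submodule.zero_mem _

theorem d0Gen_of_col_eq (i j : Fin (m + n)) (h : col m n i = col m n j) :
    d0Gen m n k i j =
      (∑ h, if col m n h = col m n i + 1 ∧ row m n h = row m n i then psiA m n k h j else 0)
      - (∑ l, if col m n l + 1 = col m n j ∧ row m n l = row m n j then psiA m n k i l else 0) := by
  unfold d0Gen
  rw [Finset.sum_eq_zero (fun r _ => if_neg (by omega)),
    Finset.sum_eq_zero (fun r _ => if_neg (by omega)), if_neg (by omega)]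
  simp

theorem col_row_iff (h' : n ≤ m) (h : Fin (m + n)) (i : Fin m) (c : ℕ) :
    (col m n h = c ∧ row m n h = i) ↔
      ((h : ℕ) = i ∧ c = 1) ∨ ((h : ℕ) = i + n ∧ m - n ≤ (i : ℕ) ∧ c = 2) := by
  have := i.2
  have := h.2
  unfold col row
  split_ifs <;> omega

theorem sum_two_boxes {G : Type*} [AddCommMonoid G] (hmn : n ≤ m)
    (F : Fin (m + n) → Fin (m + n) → G) (i j : Fin m) (hi : m - n ≤ (i : ℕ))
    (hj : m - n ≤ (j : ℕ)) (hn : n ≠ 0) :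
    (∑ h, ∑ l, if row m n h = i ∧ row m n l = j ∧ col m n h = col m n l then F h l else 0)
      = F ⟨i, by omega⟩ ⟨j, by omega⟩ + F ⟨i + n, by omega⟩ ⟨j + n, by omega⟩ := by
  have him := i.2
  have hjm := j.2
  have hone : ∀ (c : ℕ) (h l₀ : Fin (m + n)), col m n h = c → row m n h = i →
      col m n l₀ = c → row m n l₀ = j →
      (∑ l, if row m n h = i ∧ row m n l = j ∧ col m n h = col m n l
        then F h l else 0) = F h l₀ := by
    intro c h l₀ h1 h2 h3 h4
    rw [Finset.sum_eq_single l₀, if_pos ⟨h2, h4, h1.trans h3.symm⟩]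
    · intro l _ hl
      refine if_neg fun H => hl (Fin.ext ?_)
      have e1 := (col_row_iff m n hmn l j _).mp ⟨rfl, H.2.1⟩
      have e2 := (col_row_iff m n hmn l₀ j _).mp ⟨rfl, h4⟩
      omega
    · intro H
      exact absurd (Finset.mem_univ _) H
  have e1 := fun c => (col_row_iff m n hmn ⟨i, by omega⟩ i c)
  have e2 := fun c => (col_row_iff m n hmn ⟨i + n, by omega⟩ i c)
  have e3 := fun c => (col_row_iff m n hmn ⟨j, by omega⟩ j c)
  have e4 := fun c => (col_row_iff m n hmn ⟨j + n, by omega⟩ j c)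
  rw [← hone 1 ⟨i, by omega⟩ ⟨j, by omega⟩ ((e1 1).mpr (by simp)).1 ((e1 1).mpr (by simp)).2
      ((e3 1).mpr (by simp)).1 ((e3 1).mpr (by simp)).2,
    ← hone 2 ⟨i + n, by omega⟩ ⟨j + n, by omega⟩ ((e2 2).mpr (by simp [hi])).1
      ((e2 2).mpr (by simp [hi])).2 ((e4 2).mpr (by simp [hj])).1 ((e4 2).mpr (by simp [hj])).2,
    ← Finset.sum_pair (a := (⟨i, by omega⟩ : Fin (m + n))) (b := ⟨i + n, by omega⟩)
      (f := fun h => ∑ l, if row m n h = i ∧ row m n l = j ∧ col m n h = col m n l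
        then F h l else 0) (by simpa using hn)]
  symm
  apply Finset.sum_subset (Finset.subset_univ _)
  intro h _ hh
  simp only [Finset.mem_insert, Finset.mem_singleton, not_or] at hh
  refine Finset.sum_eq_zero fun l _ => if_neg fun H => ?_
  rcases (col_row_iff m n hmn h i _).mp ⟨rfl, H.1⟩ with h4 | h4
  · exact hh.1 (Fin.ext h4.1)
  · exact hh.2 (Fin.ext h4.1)

theorem kerD0_of_opposite {y₁ y₂ : FieldsB m n k} {y₁' y₂' z : FieldsA m n k}
    (h₁ : GraphD0 m n k y₁ y₁' z) (h₂ : GraphD0 m n k y₂ y₂' (-z)) : y₁ + y₂ ∈ kerD0 m n k := by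
  refine ⟨y₁' + y₂', ?_⟩
  have h := GraphD0.add h₁ h₂
  rwa [add_neg_cancel] at h

/-- `W^{(1)}_{i,j}` lies in the kernel of `d₀`. -/
theorem w1Sum_ker (hmn : n ≤ m) (i j : Fin m) (hij : validW1 m n i j) :
    w1Sum m n k i j ∈ kerD0 m n k := by
  have him := i.2
  have hjm := j.2
  rcases hij with hi | ⟨hi, hj⟩
  · refine Submodule.sum_mem _ fun h _ => Submodule.sum_mem _ fun l _ => ?_
    split_ifs with H
    · have hh := (col_row_iff m n hmn h i (col m n h)).mp ⟨rfl, H.1⟩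
      have hc : col m n h = 1 := by omega
      refine ⟨eA m n k h l, ?_⟩
      have := GraphD0.gen (m := m) (n := n) (k := k) h l H.2.2.ge
      rw [d0Gen_of_col_eq m n k h l H.2.2, Finset.sum_eq_zero, Finset.sum_eq_zero,
        sub_zero] at this
      · exact this
      · intro x _
        rw [if_neg]
        have : col m n x = 1 ∨ col m n x = 2 := by unfold col; split_ifs <;> simp
        omega
      · intro x _
        rw [if_neg]
        rintro ⟨h1, h2⟩
        have := (col_row_iff m n hmn x i (col m n x)).mp ⟨rfl, h2.trans H.1⟩
        omega
    · exact Submodule.zero_mem _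
  · let a : Fin (m + n) := ⟨i, by omega⟩
    let b : Fin (m + n) := ⟨j, by omega⟩
    let a' : Fin (m + n) := ⟨i + n, by omega⟩
    let b' : Fin (m + n) := ⟨j + n, by omega⟩
    have ca : col m n a = 1 := if_pos him
    have cb : col m n b = 1 := if_pos hjm
    have ca' : col m n a' = 2 := if_neg (by simp only [a']; omega)
    have cb' : col m n b' = 2 := if_neg (by simp only [b']; omega)
    have ra : row m n a = i := if_pos him
    have rb : row m n b = j := if_pos hjm
    have ra' : row m n a' = i := by
      unfold row; rw [if_neg (by simp only [a']; omega)]; simp [a']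
    have rb' : row m n b' = j := by
      unfold row; rw [if_neg (by simp only [b']; omega)]; simp [b']
    have hn : n ≠ 0 := by omega
    have hsum : w1Sum m n k i j = eB m n k a b + eB m n k a' b' :=
      sum_two_boxes m n hmn (eB m n k) i j hi hj hn
    have g1 := GraphD0.gen (m := m) (n := n) (k := k) a b (by omega)
    have g2 := GraphD0.gen (m := m) (n := n) (k := k) a' b' (by omega)
    have v1 : d0Gen m n k a b = psiA m n k a' b := by
      rw [d0Gen_of_col_eq m n k a b (by omega), Finset.sum_eq_single a', if_pos (by omega),
        Finset.sum_eq_zero, sub_zero]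
      · intro x _
        rw [if_neg]
        have : col m n x = 1 ∨ col m n x = 2 := by unfold col; split_ifs <;> simp
        omega
      · intro x _ hx
        refine if_neg fun H => hx (Fin.ext ?_)
        have := (col_row_iff m n hmn x i _).mp ⟨rfl, H.2.trans ra⟩
        have : (a' : ℕ) = i + n := rfl
        omega
      · intro H
        exact absurd (Finset.mem_univ _) H
    have v2 : d0Gen m n k a' b' = -psiA m n k a' b := by
      rw [d0Gen_of_col_eq m n k a' b' (by omega), Finset.sum_eq_zero,
        Finset.sum_eq_single b, if_pos (by omega), zero_sub]
      · intro x _ hx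
        refine if_neg fun H => hx (Fin.ext ?_)
        have := (col_row_iff m n hmn x j _).mp ⟨rfl, H.2.trans rb'⟩
        have : (b : ℕ) = j := rfl
        omega
      · intro H
        exact absurd (Finset.mem_univ _) H
      · intro x _
        rw [if_neg]
        have : col m n x = 1 ∨ col m n x = 2 := by unfold col; split_ifs <;> simp
        omega
    rw [hsum]
    rw [v1] at g1
    rw [v2] at g2
    exact kerD0_of_opposite m n k g1 g2

/-- The element `W^{(1)}_{i,j}` of the `W`-algebra, of conformal weight `1` (the value at index
pairs for which the element is not defined is `0`). -/
noncomputable def W1 (hmn : n ≤ m) (i j : Fin m) : wWeight m n k 1 :=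
  if h : validW1 m n i j then
    ⟨w1Sum m n k i j, w1Sum_homog m n k i j, w1Sum_ker m n k hmn i j h⟩
  else 0

end WAlgebra

/-! ### The universal enveloping algebra of a graded vertex algebra -/

/-- A graded vertex algebra of fields: a graded space of fields (the piece of conformal weight `d`
being `wt d`) containing the identity field and closed under `∂` and all products. -/
structure GradedFieldAlgebra (M : Type) [AddCommGroup M] [Module ℂ M] where
  wt : ℤ → Submodule ℂ (VertexOperator ℂ M)
  id_mem : idField M ∈ wt 0
  deriv_mem : ∀ (d : ℤ) (A : VertexOperator ℂ M), A ∈ wt d → derivField A ∈ wt (d + 1)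
  nProd_mem : ∀ (d e r : ℤ) (A B : VertexOperator ℂ M), A ∈ wt d → B ∈ wt e →
    nProd r A B ∈ wt (d + e - r - 1)

section Enveloping

variable {M : Type} [AddCommGroup M] [Module ℂ M] (V : GradedFieldAlgebra M)

/-- The vacuum of `V`. -/
noncomputable def GradedFieldAlgebra.vac : V.wt 0 := ⟨idField M, V.id_mem⟩

/-- The translation operator of `V`. -/
noncomputable def GradedFieldAlgebra.del {d : ℤ} (u : V.wt d) : V.wt (d + 1) :=
  ⟨derivField u, V.deriv_mem d u u.2⟩

/-- The product `u_(r) v` in `V`. -/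
noncomputable def GradedFieldAlgebra.prod {d e : ℤ} (r : ℤ) (u : V.wt d) (v : V.wt e) :
    V.wt (d + e - r - 1) :=
  ⟨nProd r u v, V.nProd_mem d e r u v u.2 v.2⟩

/-- The symbols `u t^a` with `u` homogeneous. -/
abbrev LSymbol := Σ d : ℤ, V.wt d × ℤ

/-- The degree of `u t^a` is `a - d + 1` for `u` of conformal weight `d`. -/
def LSymbol.degree (x : LSymbol V) : ℤ := x.2.2 - x.1 + 1

variable {V} in
/-- The symbol `u t^a`. -/
def symL {d : ℤ} (u : V.wt d) (a : ℤ) : FreeAlgebra ℂ (LSymbol V) := FreeAlgebra.ι ℂ ⟨d, u, a⟩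

/-- The defining relations of the universal enveloping algebra `U(L(V))` of the Borcherds Lie
algebra `L(V) = V ⊗ ℂ[t, t⁻¹] / Im (∂ ⊗ id + id ⊗ d/dt)`, with bracket
`[u t^a, v t^b] = ∑_{r ≥ 0} C(a,r) (u_(r) v) t^(a+b-r)`. -/
inductive ULRel : FreeAlgebra ℂ (LSymbol V) → FreeAlgebra ℂ (LSymbol V) → Prop
  | add {d : ℤ} (u v : V.wt d) (a : ℤ) : ULRel (symL (u + v) a) (symL u a + symL v a)
  | smul {d : ℤ} (c : ℂ) (u : V.wt d) (a : ℤ) : ULRel (symL (c • u) a) (c • symL u a)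
  | del {d : ℤ} (u : V.wt d) (a : ℤ) :
      ULRel (symL (V.del u) a) ((-(a : ℂ)) • symL u (a - 1))
  | comm {d e : ℤ} (u : V.wt d) (v : V.wt e) (a b : ℤ) (K : ℕ)
      (hK : ∀ r : ℕ, K ≤ r → V.prod r u v = 0) :
      ULRel (symL u a * symL v b - symL v b * symL u a)
        (∑ r ∈ Finset.range K,
          ((Ring.choose a r : ℤ) : ℂ) • symL (V.prod (r : ℤ) u v) (a + b - r))

/-- The universal enveloping algebra `U(L(V))`. -/
def UL : Type := RingQuot (ULRel V)

noncomputable instance : Ring (UL V) := inferInstanceAs (Ring (RingQuot (ULRel V)))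

noncomputable instance : Algebra ℂ (UL V) := inferInstanceAs (Algebra ℂ (RingQuot (ULRel V)))

/-- The quotient map onto `U(L(V))`. -/
noncomputable def UL.mk : FreeAlgebra ℂ (LSymbol V) →ₐ[ℂ] UL V := RingQuot.mkAlgHom ℂ (ULRel V)

/-- The subspace of `U(L(V))` of degree `d`: the span of the products of `u t^a`'s of total
degree `d`. -/
noncomputable def UL.deg (d : ℤ) : Submodule ℂ (UL V) :=
  Submodule.span ℂ {X | ∃ l : List (LSymbol V), (l.map (LSymbol.degree V)).sum = d ∧
    X = (l.map fun x => UL.mk V (FreeAlgebra.ι ℂ x)).prod}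

/-- The left ideal of `U(L(V))` generated by the elements of degree `> K`. Its part of degree `d`
is `∑_{r > K} U(L(V))_{d-r} U(L(V))_r`. -/
noncomputable def UL.high (K : ℕ) : Ideal (UL V) :=
  Ideal.span {X | ∃ r : ℤ, (K : ℤ) < r ∧ X ∈ UL.deg V r}

theorem UL.high_anti {K L : ℕ} (h : K ≤ L) : UL.high V L ≤ UL.high V K := by
  apply Ideal.span_mono
  rintro X ⟨r, hr, hX⟩
  exact ⟨r, by omega, hX⟩

theorem UL.deg_mul_gen {d : ℤ} {X : UL V} (hX : X ∈ UL.deg V d) (x : LSymbol V) :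
    X * UL.mk V (FreeAlgebra.ι ℂ x) ∈ UL.deg V (d + LSymbol.degree V x) := by
  induction hX using Submodule.span_induction with
  | mem Y hY =>
    obtain ⟨l, hl, rfl⟩ := hY
    exact Submodule.subset_span ⟨l ++ [x], by simp [hl], by simp⟩
  | zero => simp
  | add Y Z _ _ hY hZ => rw [add_mul]; exact Submodule.add_mem _ hY hZ
  | smul c Y _ hY => rw [smul_mul_assoc]; exact Submodule.smul_mem _ _ hY

theorem UL.high_mul_right (x : UL V) :
    ∃ E : ℕ, ∀ (K : ℕ) (Y : UL V), Y ∈ UL.high V (K + E) → Y * x ∈ UL.high V K := by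
  obtain ⟨X, rfl⟩ := RingQuot.mkAlgHom_surjective ℂ (ULRel V) x
  change ∃ E : ℕ, ∀ (K : ℕ) (Y : UL V), Y ∈ UL.high V (K + E) → Y * UL.mk V X ∈ UL.high V K
  induction X using FreeAlgebra.induction with
  | grade0 r =>
    refine ⟨0, fun K Y hY => ?_⟩
    rw [AlgHom.commutes, ← Algebra.commutes]
    exact Ideal.mul_mem_left _ _ hY
  | grade1 s =>
    refine ⟨(LSymbol.degree V s).natAbs, fun K Y hY => ?_⟩
    induction hY using Submodule.span_induction with
    | mem Z hZ =>
      obtain ⟨r, hr, hZ⟩ := hZ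
      exact Ideal.subset_span ⟨r + LSymbol.degree V s, by
        have := neg_abs_le (LSymbol.degree V s)
        push_cast at hr
        omega, UL.deg_mul_gen V hZ s⟩
    | zero => simp
    | add Z Z' _ _ hZ hZ' => rw [add_mul]; exact Ideal.add_mem _ hZ hZ'
    | smul c Z _ hZ => rw [smul_eq_mul, mul_assoc]; exact Ideal.mul_mem_left _ _ hZ
  | mul a b ha hb =>
    obtain ⟨E, hE⟩ := ha
    obtain ⟨E', hE'⟩ := hb
    refine ⟨E' + E, fun K Y hY => ?_⟩
    rw [map_mul, ← mul_assoc]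
    exact hE' K _ (hE (K + E') Y (by rwa [add_assoc]))
  | add a b ha hb =>
    obtain ⟨E, hE⟩ := ha
    obtain ⟨E', hE'⟩ := hb
    refine ⟨E + E', fun K Y hY => ?_⟩
    rw [map_add, mul_add]
    exact Ideal.add_mem _ (hE K Y (UL.high_anti V (by omega) hY))
      (hE' K Y (UL.high_anti V (by omega) hY))

theorem UL.basis : RingSubgroupsBasis (fun K : ℕ => (UL.high V K).toAddSubgroup) where
  inter i j := ⟨max i j, le_inf (UL.high_anti V (le_max_left i j))
    (UL.high_anti V (le_max_right i j))⟩
  mul i := ⟨i, by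
    rintro _ ⟨x, _, y, hy, rfl⟩
    exact Ideal.mul_mem_left _ _ hy⟩
  leftMul x i := ⟨i, fun _ hy => Ideal.mul_mem_left _ _ hy⟩
  rightMul x i := by
    obtain ⟨E, hE⟩ := UL.high_mul_right V x
    exact ⟨i + E, fun y hy => hE i y hy⟩

/-- The linear topology on `U(L(V))` with the left ideals `UL.high V K` as basis at zero. -/
noncomputable instance : TopologicalSpace (UL V) := (UL.basis V).topology

instance : IsTopologicalRing (UL V) := (UL.basis V).toRingFilterBasis.isTopologicalRing

noncomputable instance : UniformSpace (UL V) := IsTopologicalAddGroup.rightUniformSpace (UL V)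

instance : IsUniformAddGroup (UL V) := isUniformAddGroup_of_addCommGroup

instance : UniformContinuousConstSMul ℂ (UL V) where
  uniformContinuous_const_smul c := by
    have h : (fun x : UL V => c • x) = fun x => algebraMap ℂ (UL V) c * x := by
      funext x
      rw [Algebra.smul_def]
    exact uniformContinuous_of_continuousAt_zero (DistribSMul.toAddMonoidHom (UL V) c)
      (by
        change ContinuousAt (fun x : UL V => c • x) 0
        rw [h]
        exact (continuous_const.mul continuous_id).continuousAt)

/-- The completion `lim_K U(L(V)) / UL.high V K`. -/
abbrev ULHat : Type := UniformSpace.Completion (UL V)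

/-- The degree `d` part `lim_K U(L(V))_d / ∑_{r > K} U(L(V))_{d-r} U(L(V))_r` of the degreewise
completion: the closure of `U(L(V))_d`. -/
def ULHat.deg (d : ℤ) : Set (ULHat V) :=
  closure ((fun x : UL V => (x : ULHat V)) '' (UL.deg V d : Set (UL V)))

/-- The standard degreewise completion of `U(L(V))`: the subalgebra `⨁_d ULHat.deg V d`. -/
noncomputable def ULComp : Subalgebra ℂ (ULHat V) := Algebra.adjoin ℂ (⋃ d, ULHat.deg V d)

variable {V} in
/-- The element `u t^a` of the completion. -/
noncomputable def modeHat {d : ℤ} (u : V.wt d) (a : ℤ) : ULHat V :=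
  ((UL.mk V (symL u a) : UL V) : ULHat V)

variable {V} in
theorem modeHat_mem {d : ℤ} (u : V.wt d) (a : ℤ) : modeHat u a ∈ ULComp V := by
  apply Algebra.subset_adjoin
  refine Set.mem_iUnion.mpr ⟨LSymbol.degree V ⟨d, u, a⟩, subset_closure ⟨_, ?_, rfl⟩⟩
  exact Submodule.subset_span ⟨[⟨d, u, a⟩], by simp, by simp [symL]⟩

/-- The two-sided ideal of the degreewise completion generated by the elements
`(u_(a) v) t^b - ∑_{i ≥ 0} C(a,i) (-1)^i (u t^(a-i) v t^(b+i) - (-1)^a v t^(a+b-i) u t^i)`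
and `|0⟩ t^(-1) - 1`. -/
noncomputable def borcherdsIdeal : TwoSidedIdeal (ULComp V) :=
  TwoSidedIdeal.span
    ({X | ∃ (d e : ℤ) (u : V.wt d) (v : V.wt e) (a b : ℤ),
        HasSum (fun i : ℕ => (((Ring.choose a i : ℤ) : ℂ) * (-1) ^ i) •
            (modeHat u (a - i) * modeHat v (b + i)
              - ((-1 : ℂ) ^ a) • (modeHat v (a + b - i) * modeHat u i)))
          (modeHat (V.prod a u v) b - (X : ULHat V))}
      ∪ {X | (X : ULHat V) = modeHat V.vac (-1) - 1})

/-- The relations `x = 0` for the homogeneous elements `x` of the completion of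
`borcherdsIdeal V`. -/
def EnvRel (x y : ULComp V) : Prop :=
  y = 0 ∧ ∃ d : ℤ, (x : ULHat V) ∈
    closure ((fun z : ULComp V => (z : ULHat V)) ''
      {z | z ∈ borcherdsIdeal V ∧ (z : ULHat V) ∈ ULHat.deg V d})

/-- The universal enveloping algebra `𝒰(V)`: the quotient of the degreewise completion of
`U(L(V))` by the completion of the ideal `borcherdsIdeal V`. -/
def EnvAlg : Type := RingQuot (EnvRel V)

noncomputable instance : Ring (EnvAlg V) := inferInstanceAs (Ring (RingQuot (EnvRel V)))

noncomputable instance : Algebra ℂ (EnvAlg V) := inferInstanceAs (Algebra ℂ (RingQuot (EnvRel V)))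

variable {V} in
/-- The element `u t^a` of `𝒰(V)`. -/
noncomputable def mode {d : ℤ} (u : V.wt d) (a : ℤ) : EnvAlg V :=
  RingQuot.mkAlgHom ℂ (EnvRel V) ⟨modeHat u a, modeHat_mem u a⟩

end Enveloping

/-- The `W`-algebra `W^k(gl(m+n), f)` as a graded vertex algebra of fields. -/
noncomputable def wVertexAlgebra (m n : ℕ) (k : ℂ) : GradedFieldAlgebra (StatesB m n k) where
  wt := wWeight m n k
  id_mem := ⟨HomogB.vac, _, GraphD0.vac⟩
  deriv_mem := by
    rintro d A ⟨hA, A', hA'⟩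
    refine ⟨HomogB.deriv hA, derivField A', ?_⟩
    have h := GraphD0.deriv hA'
    rwa [derivField_zero] at h
  nProd_mem := by
    rintro d e r A B ⟨hA, A', hA'⟩ ⟨hB, B', hB'⟩
    refine ⟨HomogB.nProd r hA hB, nProd r A' B', ?_⟩
    have h := GraphD0.nProd r hA' hB'
    rwa [zero_nProd, nProd_zero, add_zero] at h

/-!
The elements `W^{(1)}_{i,j}` are themselves currents: `W^{(1)}_{i,j}` is the field of the block
diagonal matrix `w1Mat i j ∈ 𝔟`, the sum of the matrix units joining row `i` to row `j` inside a
column (`w1Sum_eq_current`). For two currents the Borcherds sum defining the `s`-th product with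
`s ≥ 0` collapses, after reversing one half, to an alternating binomial sum of commutators
`[x t^(s-i), y t^(b+i)]`, which are affine linear in `i` (`nProd_currentE_ncoeff`). Hence the zeroth
product is the current of `[x, y]`, the first one is `κ(x, y)|0⟩`, and all higher ones vanish.

It remains to compute in `𝔟`. On valid index pairs the matrices `w1Mat` multiply like matrix
units (`w1Mat_mul`), which gives the bracket, and `κ` on block diagonal matrices is a combination
of block traces of `x * y` and products of block traces of `x` and `y` (`kappa_w1Elt`).

The commutator in the enveloping algebra follows from the bracket of `L(V)`. Only the zeroth and
first products contribute, and the vacuum modes that appear are scalars: `|0⟩ t^(-1) = 1` is one of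
the defining relations, and `|0⟩ t^a = 0` for `a ≠ -1` because `∂|0⟩ = 0` (`mode_vac`).
-/

/-! ### Nonnegative products of even currents -/

section Affine

variable {𝔤 N : Type} [LieRing 𝔤] [LieAlgebra ℂ 𝔤] [AddCommGroup N] [Module ℂ N]
  [LieRingModule 𝔤 N] (κ : LinearMap.BilinForm ℂ 𝔤)

theorem modeE_add (x y : 𝔤) (a : ℤ) :
    modeE 𝔤 N κ (x + y) a = modeE 𝔤 N κ x a + modeE 𝔤 N κ y a := by
  exact (RingQuot.mkAlgHom_rel ℂ (ModeRel.addE (N := N) (κ := κ) x y a)).trans (map_add _ _ _)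

theorem modeE_smul (c : ℂ) (x : 𝔤) (a : ℤ) :
    modeE 𝔤 N κ (c • x) a = c • modeE 𝔤 N κ x a := by
  exact (RingQuot.mkAlgHom_rel ℂ (ModeRel.smulE (N := N) (κ := κ) c x a)).trans (map_smul _ _ _)

@[simp]
theorem ncoeff_currentE (x : 𝔤) (a : ℤ) (v : VacuumModule 𝔤 N κ) :
    VertexOperator.ncoeff (currentE N κ x) a v = modeE 𝔤 N κ x a • v := by
  simp [currentE]

variable (N) in
/-- The linear map sending an even element `x` to the current `x(z)`. -/
noncomputable def currentELinear : 𝔤 →ₗ[ℂ] VertexOperator ℂ (VacuumModule 𝔤 N κ) where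
  toFun := currentE N κ
  map_add' x y := field_ext fun a v => by simp [modeE_add, add_smul]
  map_smul' c x := field_ext fun a v => by simp [modeE_smul]

/-- The commutator of two modes of currents, applied to a vector. -/
theorem modeE_smul_smul_sub (x y : 𝔤) (a b : ℤ) (v : VacuumModule 𝔤 N κ) :
    modeE 𝔤 N κ x a • modeE 𝔤 N κ y b • v - modeE 𝔤 N κ y b • modeE 𝔤 N κ x a • v
      = modeE 𝔤 N κ ⁅x, y⁆ (a + b) • v + (if a + b = 0 then (a : ℂ) * κ x y else 0) • v := by
  rw [smul_smul, smul_smul, modeE_comm_E, add_smul, add_sub_cancel_left, add_smul,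
    algebraMap_smul]

variable (N)

/-- For `s ≥ 0` the sum defining the `s`-th product, once its second half is reversed, consists
of commutators of modes only. -/
theorem nProd_currentE_ncoeff (s : ℕ) (x y : 𝔤) (b : ℤ) (v : VacuumModule 𝔤 N κ) :
    VertexOperator.ncoeff (nProd s (currentE N κ x) (currentE N κ y)) b v
      = ∑ i ∈ Finset.range (s + 1), ((-1 : ℂ) ^ i * (s.choose i : ℂ)) •
        (modeE 𝔤 N κ ⁅x, y⁆ (s + b) • v
          + (if s + b = 0 then ((s : ℂ) - i) * κ x y else 0) • v) := by
  rw [nProd_ncoeff, finsum_eq_sum_of_support_subset (s := Finset.range (s + 1))]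
  · simp only [nProdTerm, smul_sub, Finset.sum_sub_distrib, ncoeff_currentE]
    rw [← Finset.sum_range_reflect (fun i : ℕ =>
      ((-1 : ℂ) ^ i * ((Ring.choose (s : ℤ) i : ℤ) : ℂ)) •
        ((-1 : ℂ) ^ (s : ℤ)) • modeE 𝔤 N κ y (s + b - i) • modeE 𝔤 N κ x i • v),
      ← Finset.sum_sub_distrib]
    refine Finset.sum_congr rfl fun i hi => ?_
    have hi : i ≤ s := Nat.lt_succ_iff.mp (Finset.mem_range.mp hi)
    have e : s + 1 - 1 - i = s - i := by omega
    have hsign : (-1 : ℂ) ^ (s - i) * (-1) ^ s = (-1) ^ i := by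
      obtain ⟨d, rfl⟩ := Nat.exists_eq_add_of_le hi
      rw [Nat.add_sub_cancel_left, ← pow_add,
        show d + (i + d) = i + 2 * d by ring, pow_add, pow_mul]
      simp
    have hcomm := modeE_smul_smul_sub κ x y (s - i) (b + i) v
    rw [show (s - i + (b + i) : ℤ) = s + b by ring] at hcomm
    push_cast at hcomm
    rw [← hcomm, smul_sub, e, smul_smul _ ((-1 : ℂ) ^ (s : ℤ)), zpow_natCast,
      Ring.choose_natCast, Ring.choose_natCast, Nat.choose_symm hi,
      show (s + b - ((s - i : ℕ) : ℤ)) = b + i by push_cast [hi]; ring, Nat.cast_sub hi,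
      mul_right_comm, hsign]
    simp
  · intro i hi
    by_contra h
    refine hi ?_
    have h : s < i := by simpa using h
    rw [nProdTerm, Ring.choose_natCast, Nat.choose_eq_zero_of_lt h]
    simp

theorem nProd_zero_currentE (x y : 𝔤) :
    nProd 0 (currentE N κ x) (currentE N κ y) = currentE N κ ⁅x, y⁆ := by
  refine field_ext fun b v => ?_
  simpa using nProd_currentE_ncoeff N κ 0 x y b v

theorem nProd_one_currentE (x y : 𝔤) :
    nProd 1 (currentE N κ x) (currentE N κ y) = κ x y • idField (VacuumModule 𝔤 N κ) := by
  refine field_ext fun b v => ?_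
  have h := nProd_currentE_ncoeff N κ 1 x y b v
  rw [Nat.cast_one] at h
  rw [h]
  have hb : 1 + b = 0 ↔ b = -1 := by omega
  by_cases h1 : b = -1 <;> simp [Finset.sum_range_succ, idField, hb, h1]

/-- The products of order at least two vanish, because the alternating binomial sums of a
polynomial of degree one do. -/
theorem nProd_currentE_eq_zero (x y : 𝔤) (s : ℤ) (hs : 1 < s) :
    nProd s (currentE N κ x) (currentE N κ y) = 0 := by
  lift s to ℕ using by omega
  obtain ⟨s, rfl⟩ := Nat.exists_eq_add_of_le' (show 2 ≤ s by omega)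
  refine field_ext fun b v => ?_
  rw [nProd_currentE_ncoeff]
  have h0 : ∑ i ∈ Finset.range (s + 2 + 1), ((-1 : ℂ) ^ i * ((s + 2).choose i : ℂ)) = 0 := by
    exact_mod_cast Int.alternating_sum_range_choose_of_ne (show s + 2 ≠ 0 by omega)
  have h1 : ∑ i ∈ Finset.range (s + 2 + 1),
      ((-1 : ℂ) ^ i * ((s + 2).choose i : ℂ)) * (((s + 2 : ℕ) : ℂ) - i) = 0 := by
    rw [Finset.sum_range_succ, sub_self, mul_zero, add_zero]
    -- `C(s + 2, i) (s + 2 - i) = (s + 2) C(s + 1, i)` reduces this to the previous identity.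
    have h2 : ∑ i ∈ Finset.range (s + 1 + 1), ((-1 : ℂ) ^ i * ((s + 1).choose i : ℂ)) = 0 := by
      exact_mod_cast Int.alternating_sum_range_choose_of_ne (show s + 1 ≠ 0 by omega)
    rw [← mul_zero ((s + 2 : ℕ) : ℂ), ← h2, Finset.mul_sum]
    refine Finset.sum_congr rfl fun i hi => ?_
    have hi : i ≤ s + 1 := Nat.lt_succ_iff.mp (Finset.mem_range.mp hi)
    have h3 := Nat.choose_mul_succ_eq (s + 1) i
    have h4 : ((s + 1).choose i : ℂ) * ((s + 2 : ℕ) : ℂ)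
        = ((s + 2).choose i : ℂ) * (((s + 2 : ℕ) : ℂ) - i) := by
      rw [← Nat.cast_sub (by omega)]
      exact_mod_cast h3
    rw [mul_assoc, ← h4]
    ring
  simp only [smul_add, Finset.sum_add_distrib, ← Finset.sum_smul]
  rw [h0, zero_smul, zero_add]
  split_ifs
  · simp only [smul_smul, ← Finset.sum_smul, ← mul_assoc, ← Finset.sum_mul]
    rw [h1]
    simp
  · simp

end Affine

/-! ### Currents of block diagonal matrices in the `W`-algebra -/

section WAlgebra

variable (m n : ℕ)

/-- The matrix of `W^{(1)}_{i,j}`: the sum of the `e_{h,l}` over all `h` in row `i` and `l` in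
row `j` of equal column. -/
def w1Mat (i j : Fin m) : glMat m n :=
  Matrix.of fun a b => if row m n a = i ∧ row m n b = j ∧ col m n a = col m n b then 1 else 0

/-- Two boxes at most are in row `i`: one in the first column, and one in the second if the row
is long. -/
theorem sum_box (hmn : n ≤ m) (i : Fin m) (c : ℕ) :
    (∑ a, if row m n a = i ∧ col m n a = c then (1 : ℂ) else 0)
      = if c = 1 ∨ (c = 2 ∧ m - n ≤ (i : ℕ)) then 1 else 0 := by
  have hi := i.2
  have H := fun a => col_row_iff m n hmn a i c
  by_cases h1 : c = 1
  · rw [if_pos (Or.inl h1), Finset.sum_eq_single ⟨i, by omega⟩]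
    · exact if_pos ((H _).mpr (Or.inl ⟨rfl, h1⟩)).symm
    · intro a _ ha
      refine if_neg fun h => ha (Fin.ext ?_)
      have := (H a).mp h.symm
      simp only
      omega
    · intro h
      exact absurd (Finset.mem_univ _) h
  by_cases h2 : c = 2 ∧ m - n ≤ (i : ℕ)
  · rw [if_pos (Or.inr h2), Finset.sum_eq_single ⟨i + n, by omega⟩]
    · exact if_pos ((H _).mpr (Or.inr ⟨rfl, h2.2, h2.1⟩)).symm
    · intro a _ ha
      refine if_neg fun h => ha (Fin.ext ?_)
      have := (H a).mp h.symm
      simp only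
      omega
    · intro h
      exact absurd (Finset.mem_univ _) h
  · rw [if_neg (by tauto)]
    refine Finset.sum_eq_zero fun a _ => if_neg fun h => ?_
    have := (H a).mp h.symm
    tauto

/-- The matrices attached to valid index pairs multiply like matrix units: the box in the middle
row exists, since a long row can only be followed by a long row. -/
theorem w1Mat_mul (hmn : n ≤ m) (p q i j : Fin m) (hpq : validW1 m n p q) :
    w1Mat m n p q * w1Mat m n i j = if q = i then w1Mat m n p j else 0 := by
  ext a b
  rw [Matrix.mul_apply]
  split_ifs with hqi
  · subst hqi
    by_cases hab : row m n a = p ∧ row m n b = j ∧ col m n a = col m n b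
    · have := (col_row_iff m n hmn a p _).mp ⟨rfl, hab.1⟩
      have hbox := sum_box m n hmn q (col m n a)
      rw [if_pos (by unfold validW1 at hpq; omega)] at hbox
      simp only [w1Mat, Matrix.of_apply]
      rw [if_pos hab]
      refine Eq.trans ?_ hbox
      refine Finset.sum_congr rfl fun c _ => ?_
      by_cases hc : row m n c = q ∧ col m n c = col m n a
      · rw [if_pos hc, if_pos ⟨hab.1, hc.1, hc.2.symm⟩,
          if_pos ⟨hc.1, hab.2.1, hc.2.trans hab.2.2⟩, one_mul]
      · rw [if_neg hc, if_neg (by tauto), zero_mul]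
    · simp only [w1Mat, Matrix.of_apply]
      rw [if_neg hab]
      refine Finset.sum_eq_zero fun c _ => ?_
      split_ifs with h1 h2
      · exact absurd ⟨h1.1, h2.2.1, h1.2.2.trans h2.2.2⟩ hab
      all_goals simp
  · refine Finset.sum_eq_zero fun c _ => ?_
    simp only [w1Mat, Matrix.of_apply]
    split_ifs with h1 h2
    · exact absurd (Fin.ext (h1.2.1.symm.trans h2.1)) hqi
    all_goals simp

theorem blockTrace_w1Mat (hmn : n ≤ m) (c : ℕ) (i j : Fin m) :
    blockTrace m n c (w1Mat m n i j)
      = if i = j ∧ (c = 1 ∨ (c = 2 ∧ m - n ≤ (i : ℕ))) then 1 else 0 := by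
  rw [ite_and, ← sum_box m n hmn, blockTrace]
  split_ifs with hij
  · subst hij
    refine Finset.sum_congr rfl fun a _ => ?_
    simp only [w1Mat, Matrix.of_apply]
    split_ifs <;> tauto
  · refine Finset.sum_eq_zero fun a _ => ?_
    simp only [w1Mat, Matrix.of_apply]
    split_ifs with h1 h2
    · exact absurd (Fin.ext (h2.1.symm.trans h2.2.1)) hij
    all_goals rfl

/-- For block diagonal `x`, the trace form of a diagonal block is the block trace of the
product. -/
theorem blockPairing_eq_blockTrace_mul (c : ℕ) (x y : glMat m n)
    (hx : ∀ i j, col m n i ≠ col m n j → x i j = 0) :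
    blockPairing m n c x y = blockTrace m n c (x * y) := by
  refine Finset.sum_congr rfl fun i _ => ?_
  by_cases hi : col m n i = c
  · rw [if_pos hi, Matrix.mul_apply]
    refine Finset.sum_congr rfl fun j _ => ?_
    split_ifs with h
    · rfl
    · rw [hx i j (by omega), zero_mul]
  · rw [if_neg hi]
    exact Finset.sum_eq_zero fun j _ => if_neg fun h => hi h.1

/-- The matrix `w1Mat` as an element of `𝔟`. -/
def w1Elt (i j : Fin m) : lieB m n :=
  ⟨w1Mat m n i j, fun _ _ h => if_neg fun H => h.ne H.2.2⟩

theorem w1Elt_lie (hmn : n ≤ m) (p q i j : Fin m) (hpq : validW1 m n p q)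
    (hij : validW1 m n i j) :
    ⁅w1Elt m n p q, w1Elt m n i j⁆
      = (if q = i then w1Elt m n p j else 0) - (if p = j then w1Elt m n i q else 0) := by
  apply Subtype.ext
  rw [LieSubalgebra.coe_bracket, Ring.lie_def]
  change w1Mat m n p q * w1Mat m n i j - w1Mat m n i j * w1Mat m n p q = _
  rw [w1Mat_mul m n hmn p q i j hpq, w1Mat_mul m n hmn i j p q hij]
  simp only [eq_comm (a := j) (b := p)]
  split_ifs <;> rfl

theorem w1Elt_eq_sum (i j : Fin m) :
    w1Elt m n i j = ∑ h, ∑ l, if row m n h = i ∧ row m n l = j ∧ col m n h = col m n l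
      then eElt m n h l else 0 := by
  apply Subtype.ext
  have hcoe : ∀ h l, ((if row m n h = i ∧ row m n l = j ∧ col m n h = col m n l
      then eElt m n h l else 0 : lieB m n) : glMat m n)
        = Matrix.single h l (w1Mat m n i j h l) := by
    intro h l
    simp only [w1Mat, Matrix.of_apply]
    split_ifs with H
    · rw [eElt, dif_pos H.2.2.ge]
    · simp
  simp only [AddSubmonoidClass.coe_finsetSum, hcoe]
  exact Matrix.matrix_eq_sum_single _

variable (k : ℂ)

theorem kappa_w1Elt (hmn : n ≤ m) (p q i j : Fin m) (hpq : validW1 m n p q) :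
    kappa m n k (w1Elt m n p q) (w1Elt m n i j)
      = (if q = i ∧ p = j then
            alpha1 n k + (if m - n ≤ (p : ℕ) ∧ m - n ≤ (i : ℕ) then alpha2 m k else 0)
          else 0)
        + (if p = q ∧ i = j then
            1 + (if m - n ≤ (p : ℕ) ∧ m - n ≤ (i : ℕ) then (1 : ℂ) else 0)
          else 0) := by
  have hp : ∀ c, blockPairing m n c (w1Mat m n p q) (w1Mat m n i j)
      = if q = i ∧ p = j ∧ (c = 1 ∨ (c = 2 ∧ m - n ≤ (p : ℕ))) then 1 else 0 := by
    intro c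
    have hdiag : ∀ a b, col m n a ≠ col m n b → w1Mat m n p q a b = 0 :=
      fun _ _ h => if_neg fun H => h H.2.2
    rw [blockPairing_eq_blockTrace_mul m n c _ _ hdiag,
      w1Mat_mul m n hmn p q i j hpq, ite_and, ← blockTrace_w1Mat m n hmn]
    split_ifs
    · rfl
    · simp [blockTrace]
  have hlong : q = i → m - n ≤ (p : ℕ) → m - n ≤ (i : ℕ) := by
    rintro rfl h
    unfold validW1 at hpq
    omega
  change (alpha1 n k * blockPairing m n 1 (w1Mat m n p q) (w1Mat m n i j)
      + blockTrace m n 1 (w1Mat m n p q) * blockTrace m n 1 (w1Mat m n i j))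
    + (alpha2 m k * blockPairing m n 2 (w1Mat m n p q) (w1Mat m n i j)
      + blockTrace m n 2 (w1Mat m n p q) * blockTrace m n 2 (w1Mat m n i j)) = _
  simp only [hp, blockTrace_w1Mat m n hmn, true_or, and_true, OfNat.ofNat_ne_one, false_or,
    true_and]
  simp only [ite_and]
  split_ifs <;> first | ring1 | exact absurd (hlong ‹_› ‹_›) ‹_›

/-- `W^{(1)}_{i,j}` is the current of `w1Elt`. -/
theorem w1Sum_eq_current (i j : Fin m) :
    w1Sum m n k i j
      = currentE (⊥ : LieSubmodule ℂ (lieB m n) (glMat m n)) (kappa m n k) (w1Elt m n i j) := by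
  change _ = currentELinear (⊥ : LieSubmodule ℂ (lieB m n) (glMat m n)) (kappa m n k)
    (w1Elt m n i j)
  rw [w1Elt_eq_sum, map_sum]
  refine Finset.sum_congr rfl fun h _ => ?_
  rw [map_sum]
  refine Finset.sum_congr rfl fun l _ => ?_
  split_ifs
  · rfl
  · exact (map_zero (currentELinear (⊥ : LieSubmodule ℂ (lieB m n) (glMat m n)) _)).symm

theorem coe_W1 (hmn : n ≤ m) (i j : Fin m) (h : validW1 m n i j) :
    (W1 m n k hmn i j : FieldsB m n k)
      = currentE (⊥ : LieSubmodule ℂ (lieB m n) (glMat m n)) (kappa m n k) (w1Elt m n i j) := by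
  rw [W1, dif_pos h]
  exact w1Sum_eq_current m n k i j

/-- The index pairs `(p, j)` and `(i, q)` are again valid whenever the corresponding term on the
right occurs, so that the value `0` of `W1` at other pairs plays no role. -/
theorem nProd_zero_W1 (hmn : n ≤ m) (p q i j : Fin m) (hpq : validW1 m n p q)
    (hij : validW1 m n i j) :
    nProd 0 (W1 m n k hmn p q : FieldsB m n k) (W1 m n k hmn i j : FieldsB m n k)
      = (if q = i then (W1 m n k hmn p j : FieldsB m n k) else 0)
        - (if p = j then (W1 m n k hmn i q : FieldsB m n k) else 0) := by
  rw [coe_W1 m n k hmn p q hpq, coe_W1 m n k hmn i j hij]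
  refine (nProd_zero_currentE _ (kappa m n k) _ _).trans ?_
  rw [w1Elt_lie m n hmn p q i j hpq hij]
  refine (map_sub (currentELinear (⊥ : LieSubmodule ℂ (lieB m n) (glMat m n)) (kappa m n k))
    _ _).trans ?_
  unfold validW1 at hpq hij
  congr 1
  · split_ifs with h
    · exact (coe_W1 m n k hmn p j (by subst h; unfold validW1; omega)).symm
    · exact map_zero (currentELinear (⊥ : LieSubmodule ℂ (lieB m n) (glMat m n)) _)
  · split_ifs with h
    · exact (coe_W1 m n k hmn i q (by subst h; unfold validW1; omega)).symm
    · exact map_zero (currentELinear (⊥ : LieSubmodule ℂ (lieB m n) (glMat m n)) _)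

theorem nProd_one_W1 (hmn : n ≤ m) (p q i j : Fin m) (hpq : validW1 m n p q)
    (hij : validW1 m n i j) :
    nProd 1 (W1 m n k hmn p q : FieldsB m n k) (W1 m n k hmn i j : FieldsB m n k)
      = kappa m n k (w1Elt m n p q) (w1Elt m n i j) • idField (StatesB m n k) := by
  rw [coe_W1 m n k hmn p q hpq, coe_W1 m n k hmn i j hij]
  exact nProd_one_currentE _ (kappa m n k) _ _

theorem nProd_W1_eq_zero (hmn : n ≤ m) (p q i j : Fin m) (hpq : validW1 m n p q)
    (hij : validW1 m n i j) (s : ℤ) (hs : 1 < s) :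
    nProd s (W1 m n k hmn p q : FieldsB m n k) (W1 m n k hmn i j : FieldsB m n k) = 0 := by
  rw [coe_W1 m n k hmn p q hpq, coe_W1 m n k hmn i j hij]
  exact nProd_currentE_eq_zero _ (kappa m n k) _ _ s hs

end WAlgebra

/-! ### Modes in the enveloping algebra -/

section Enveloping

variable {M : Type} [AddCommGroup M] [Module ℂ M] {V : GradedFieldAlgebra M}

variable (V) in
/-- The canonical map from the free algebra on the symbols `u t^a` to the completion of
`U(L(V))`. -/
noncomputable def freeToULHat : FreeAlgebra ℂ (LSymbol V) →ₐ[ℂ] ULHat V :=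
  AlgHom.comp
    { (UniformSpace.Completion.coeRingHom : UL V →+* ULHat V) with commutes' := fun _ => rfl }
    (UL.mk V)

theorem freeToULHat_mem (X : FreeAlgebra ℂ (LSymbol V)) : freeToULHat V X ∈ ULComp V := by
  induction X using FreeAlgebra.induction with
  | grade0 r => exact (AlgHom.commutes (freeToULHat V) r).symm ▸ (ULComp V).algebraMap_mem r
  | grade1 s => exact modeHat_mem s.2.1 s.2.2
  | mul a b ha hb => rw [map_mul]; exact mul_mem ha hb
  | add a b ha hb => rw [map_add]; exact add_mem ha hb

variable (V) in
/-- The canonical map from the free algebra on the symbols `u t^a` to `𝒰(V)`. -/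
noncomputable def freeToEnv : FreeAlgebra ℂ (LSymbol V) →ₐ[ℂ] EnvAlg V :=
  AlgHom.comp (RingQuot.mkAlgHom ℂ (EnvRel V))
    ((freeToULHat V).codRestrict (ULComp V) freeToULHat_mem)

theorem freeToEnv_symL {d : ℤ} (u : V.wt d) (a : ℤ) : freeToEnv V (symL u a) = mode u a := rfl

/-- The relations of `U(L(V))` hold between the modes in `𝒰(V)`. -/
theorem freeToEnv_rel {x y : FreeAlgebra ℂ (LSymbol V)} (h : ULRel V x y) :
    freeToEnv V x = freeToEnv V y := by
  have h1 : UL.mk V x = UL.mk V y := RingQuot.mkAlgHom_rel ℂ h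
  have h2 : freeToULHat V x = freeToULHat V y :=
    congrArg (fun z : UL V => (z : ULHat V)) h1
  exact congrArg (RingQuot.mkAlgHom ℂ (EnvRel V)) (Subtype.ext h2)

theorem mode_smul {d : ℤ} (c : ℂ) (u : V.wt d) (a : ℤ) : mode (c • u) a = c • mode u a := by
  simpa [freeToEnv_symL] using freeToEnv_rel (ULRel.smul c u a)

theorem mode_add {d : ℤ} (u v : V.wt d) (a : ℤ) : mode (u + v) a = mode u a + mode v a := by
  simpa [freeToEnv_symL] using freeToEnv_rel (ULRel.add u v a)

theorem mode_zero {d : ℤ} (a : ℤ) : mode (0 : V.wt d) a = 0 := by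
  simpa using mode_smul (0 : ℂ) (0 : V.wt d) a

theorem mode_ite {d : ℤ} (P : Prop) [Decidable P] (u : V.wt d) (a : ℤ) :
    mode (if P then u else 0) a = if P then mode u a else 0 := by
  split_ifs
  · rfl
  · exact mode_zero a

theorem coe_ite_wt {d : ℤ} (P : Prop) [Decidable P] (u : V.wt d) :
    ((if P then u else 0 : V.wt d) : VertexOperator ℂ M) = if P then ↑u else 0 := by
  split_ifs <;> rfl

theorem mode_del {d : ℤ} (u : V.wt d) (a : ℤ) :
    mode (V.del u) a = (-(a : ℂ)) • mode u (a - 1) := by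
  simpa only [map_smul, freeToEnv_symL] using freeToEnv_rel (ULRel.del u a)

theorem mode_commutator {d e : ℤ} (u : V.wt d) (v : V.wt e) (a b : ℤ) (K : ℕ)
    (hK : ∀ r : ℕ, K ≤ r → V.prod r u v = 0) :
    mode u a * mode v b - mode v b * mode u a
      = ∑ r ∈ Finset.range K,
          ((Ring.choose a r : ℤ) : ℂ) • mode (V.prod (r : ℤ) u v) (a + b - r) := by
  simpa only [map_sub, map_mul, map_sum, map_smul, freeToEnv_symL] using
    freeToEnv_rel (ULRel.comm u v a b K hK)

theorem mode_congr {d e : ℤ} (u : V.wt d) (v : V.wt e) (a b : ℤ) (hd : d = e) (hab : a = b)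
    (h : (u : VertexOperator ℂ M) = v) : mode u a = mode v b := by
  subst hd hab
  rw [Subtype.ext h]

/-- The modes of the vacuum other than `|0⟩ t^(-1)` vanish since `∂|0⟩ = 0`. -/
theorem mode_vac_of_ne (a : ℤ) (ha : a ≠ -1) : mode V.vac a = 0 := by
  have hdel : V.del V.vac = 0 := by
    refine Subtype.ext (field_ext fun n v => ?_)
    by_cases hn : n = 0 <;>
      simp [GradedFieldAlgebra.del, GradedFieldAlgebra.vac, derivField, idField, hn]
  have h := mode_del V.vac (a + 1)
  rw [hdel, mode_zero, add_sub_cancel_right] at h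
  refine (smul_eq_zero.mp h.symm).resolve_left ?_
  exact neg_ne_zero.mpr (by exact_mod_cast show a + 1 ≠ 0 by omega)

theorem mode_vac_neg_one : mode V.vac (-1) = 1 := by
  have hdeg : ∀ x ∈ UL.deg V 0, (x : ULHat V) ∈ ULHat.deg V 0 :=
    fun x hx => subset_closure ⟨x, hx, rfl⟩
  have h1 : (1 : UL V) ∈ UL.deg V 0 := Submodule.subset_span ⟨[], by simp⟩
  have hv : UL.mk V (symL V.vac (-1)) ∈ UL.deg V 0 :=
    Submodule.subset_span ⟨[⟨0, V.vac, -1⟩], by simp [LSymbol.degree], by simp [symL]⟩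
  have hcoe : ((UL.mk V (symL V.vac (-1)) - 1 : UL V) : ULHat V) = modeHat V.vac (-1) - 1 :=
    map_sub (UniformSpace.Completion.coeRingHom : UL V →+* ULHat V) _ 1
  have hrel : EnvRel V (⟨modeHat V.vac (-1), modeHat_mem _ _⟩ - 1) 0 := by
    refine ⟨rfl, 0, subset_closure ⟨_, ⟨?_, ?_⟩, rfl⟩⟩
    -- `|0⟩ t^(-1) - 1` is a generator of the ideal, and it is homogeneous of degree `0`.
    · exact TwoSidedIdeal.subset_span (Or.inr rfl)
    · have := hdeg _ (Submodule.sub_mem _ hv h1)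
      rwa [hcoe] at this
  have h := RingQuot.mkAlgHom_rel ℂ hrel
  rw [map_sub, map_one, map_zero, sub_eq_zero] at h
  exact h

theorem mode_vac (a : ℤ) : mode V.vac a = if a = -1 then 1 else 0 := by
  split_ifs with h
  · rw [h, mode_vac_neg_one]
  · exact mode_vac_of_ne a h

/-- The commutator of the modes of two elements of conformal weight one whose products of order
at least two vanish and whose first product is a multiple of the vacuum. -/
theorem mode_commutator_of_weight_one (u v w₁ w₂ : V.wt 1) (c : ℂ)
    (h0 : nProd 0 (u : VertexOperator ℂ M) v = w₁ - w₂)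
    (h1 : nProd 1 (u : VertexOperator ℂ M) v = c • idField M)
    (h2 : ∀ s : ℤ, 1 < s → nProd s (u : VertexOperator ℂ M) v = 0) (a b : ℤ) :
    mode u a * mode v b - mode v b * mode u a
      = mode w₁ (a + b) - mode w₂ (a + b)
        + algebraMap ℂ _ (if a + b = 0 then (a : ℂ) * c else 0) := by
  have hsub : mode (w₁ - w₂) (a + b) = mode w₁ (a + b) - mode w₂ (a + b) := by
    have h : w₁ - w₂ + w₂ = w₁ := Subtype.ext (sub_add_cancel _ _)
    exact eq_sub_of_add_eq ((mode_add _ _ _).symm.trans (congrArg (mode · (a + b)) h))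
  rw [← hsub, mode_commutator u v a b 2 fun r hr => Subtype.ext (h2 r (by omega)),
    Finset.sum_range_succ, Finset.sum_range_one,
    mode_congr (V.prod ((0 : ℕ) : ℤ) u v) (w₁ - w₂) _ (a + b) (by simp) (by simp) h0,
    mode_congr (V.prod ((1 : ℕ) : ℤ) u v) (c • V.vac) _ (a + b - 1) (by simp) (by simp) h1,
    mode_smul, mode_vac]
  have hab : a + b - 1 = -1 ↔ a + b = 0 := by omega
  by_cases h : a + b = 0 <;> simp [hab, h, Algebra.algebraMap_eq_smul_one, mul_smul]

end Enveloping

/-! ### Products and commutators of the `W^{(1)}_{i,j}` -/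

theorem mainTheorem5 (m n : ℕ) (hmn : n ≤ m) (k : ℂ) :
    (∀ p q i j : Fin m, validW1 m n p q → validW1 m n i j →
      nProd 0 (W1 m n k hmn p q : FieldsB m n k) (W1 m n k hmn i j : FieldsB m n k)
          = (if q = i then (W1 m n k hmn p j : FieldsB m n k) else 0)
            - (if p = j then (W1 m n k hmn i q : FieldsB m n k) else 0) ∧
      nProd 1 (W1 m n k hmn p q : FieldsB m n k) (W1 m n k hmn i j : FieldsB m n k)
          = (if q = i ∧ p = j then
                alpha1 n k + (if m - n ≤ (p : ℕ) ∧ m - n ≤ (i : ℕ) then alpha2 m k else 0)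
              else 0) • idField (StatesB m n k)
            + (if p = q ∧ i = j then
                1 + (if m - n ≤ (p : ℕ) ∧ m - n ≤ (i : ℕ) then (1 : ℂ) else 0)
              else 0) • idField (StatesB m n k) ∧
      ∀ s : ℤ, 1 < s →
        nProd s (W1 m n k hmn p q : FieldsB m n k) (W1 m n k hmn i j : FieldsB m n k) = 0) ∧
    (∀ p q i j : Fin m, m - n ≤ (p : ℕ) → m - n ≤ (q : ℕ) → m - n ≤ (i : ℕ) → m - n ≤ (j : ℕ) →
      ∀ s u : ℤ,
        (mode (W1 m n k hmn p q) s * mode (W1 m n k hmn i j) u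
            - mode (W1 m n k hmn i j) u * mode (W1 m n k hmn p q) s
              : EnvAlg (wVertexAlgebra m n k))
          = (if q = i then mode (W1 m n k hmn p j) (s + u) else 0)
            - (if p = j then mode (W1 m n k hmn i q) (s + u) else 0)
            + algebraMap ℂ _
                (if s + u = 0 ∧ q = i ∧ p = j then (s : ℂ) * (alpha1 n k + alpha2 m k) else 0)
            + algebraMap ℂ _
                (if s + u = 0 ∧ p = q ∧ i = j then 2 * (s : ℂ) else 0)) := by
  refine ⟨fun p q i j hpq hij => ⟨nProd_zero_W1 m n k hmn p q i j hpq hij, ?_,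
    nProd_W1_eq_zero m n k hmn p q i j hpq hij⟩, fun p q i j hp hq hi hj s u => ?_⟩
  · rw [nProd_one_W1 m n k hmn p q i j hpq hij, kappa_w1Elt m n k hmn p q i j hpq, add_smul]
  have hpq : validW1 m n p q := Or.inr ⟨hp, hq⟩
  have hij : validW1 m n i j := Or.inr ⟨hi, hj⟩
  -- The `W1` as elements of the weight spaces of the vertex algebra, which unfold to `wWeight`.
  let W : Fin m → Fin m → (wVertexAlgebra m n k).wt 1 := W1 m n k hmn
  have h0 : nProd 0 (W p q : FieldsB m n k) (W i j : FieldsB m n k)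
      = ((if q = i then W p j else 0 : (wVertexAlgebra m n k).wt 1) : FieldsB m n k)
        - ((if p = j then W i q else 0 : (wVertexAlgebra m n k).wt 1) : FieldsB m n k) := by
    rw [coe_ite_wt, coe_ite_wt]
    exact nProd_zero_W1 m n k hmn p q i j hpq hij
  refine (mode_commutator_of_weight_one (W p q) (W i j) _ _ _ h0
    (nProd_one_W1 m n k hmn p q i j hpq hij)
    (nProd_W1_eq_zero m n k hmn p q i j hpq hij) s u).trans ?_
  rw [kappa_w1Elt m n k hmn p q i j hpq, add_assoc _ (algebraMap ℂ _ _), ← map_add, mode_ite,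
    mode_ite]
  congr 2
  simp only [hp, hi, and_self, if_true]
  split_ifs <;> first | ring1 | (exfalso; tauto)
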